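/- For complex $p$ with $|p|<1$ and $z\ne 0$ let $\theta(z;p)=\prod_{j\ge 0}(1-zp^j)(1-p^{j+1}/z)$, let $(a;q,p)_n=\prod_{j=0}^{n-1}\theta(aq^j;p)$, and let $(a;q)_n=\prod_{j=0}^{n-1}(1-aq^j)=(a;q,0)_n$. A pair of sequences $(\alpha_n)_{n\ge0},(\beta_n)_{n\ge 0}$ of complex numbers, written $\alpha_n(a,k;q,p),\beta_n(a,k;q,p)$, is called an elliptic WP Bailey pair at the parameters $(a,k;q,p)$ if for all $n\ge 0$ $$\beta_n=\sum_{r=0}^n \frac{(k/a;q,p)_{n-r}}{(q;q,p)_{n-r}}\frac{(k;q,p)_{n+r}}{(aq;q,p)_{n+r}}\,\alpha_r,$$ $$\alpha_n=\frac{\theta(aq^{2n};p)}{\theta(a;p)}\sum_{r=0}^n\frac{\theta(kq^{2r};p)}{\theta(k;p)}\frac{(a/k;q,p)_{n-r}}{(q;q,p)_{n-r}}\frac{(a;q,p)_{n+r}}{(kq;q,p)_{n+r}}\Bigl(\frac ka\Bigr)^{n-r}\beta_r .$$ A (basic) WP Bailey pair at $(a,k;q)$ is defined by the same two relations with $\theta(z;p)$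 replaced by $1-z$ and $(\,\cdot\,;q,p)_n$ by $(\,\cdot\,;q)_n$. **Theorem (quadratic elliptic WP Bailey lemma).** Let $a,k,q$ be nonzero complex numbers, let $m=k/(aq)$, and let $|p|<1$. Assume that none of the denominators occurring in the formulas below, or in the relations defining elliptic WP Bailey pairs at $(a,m;q,p)$ and at $(a^2,k;q^2,p^2)$, vanishes. If $(\alpha_n(a,m;q,p),\beta_n(a,m;q,p))$ is an elliptic WP Bailey pair at $(a,m;q,p)$, then $$\alpha'_n(a^2,k;q^2,p^2)=\alpha_n(a,m;q,p),$$ $$\beta'_n(a^2,k;q^2,p^2)=\frac{(-mq;q,p)_{2n}}{(-aq;q,p)_{2n}}\sum_{r=0}^n\frac{\theta(mq^{2r};p)}{\theta(m;p)}\frac{(k/m^2;q^2,p^2)_{n-r}}{(q^2;q^2,p^2)_{n-r}}\frac{(k;q^2,p^2)_{n+r}}{(m^2q^2;q^2,p^2)_{n+r}}\Bigl(\frac ma\Bigr)^{n-r}\beta_r(a,m;q,p)$$ is an elliptic WP Bailey pair at $(a^2,k;q^2,p^2)$. Moreover, let $a,k,q,m$ be as above, and assume that the denominators at $p=0$ do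 not vanish. Then, as $p\to0$, for all $0\le r\le n$, the coefficients in the relations defining elliptic WP Bailey pairs at $(a,m;q,p)$ and at $(a^2,k;q^2,p^2)$, and the coefficients in the formula for $\beta'_n$, converge to the corresponding coefficients obtained by replacing each $\theta(z;\cdot)$ by $1-z$ and each elliptic shifted factorial by the basic one. The corresponding basic statement holds: if $(\alpha_n(a,m;q),\beta_n(a,m;q))$ is a WP Bailey pair at $(a,m;q)$, then $$\alpha'_n(a^2,k;q^2)=\alpha_n(a,m;q),$$ $$\beta'_n(a^2,k;q^2)=\frac{(-mq;q)_{2n}}{(-aq;q)_{2n}}\sum_{r=0}^n\frac{1-mq^{2r}}{1-m}\frac{(k/m^2;q^2)_{n-r}}{(q^2;q^2)_{n-r}}\frac{(k;q^2)_{n+r}}{(m^2q^2;q^2)_{n+r}}\Bigl(\frac ma\Bigr)^{n-r}\beta_r(a,m;q)$$ is a WP Bailey pair at $(a^2,k;q^2)$. -/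

import Mathlib

open Filter Topology

noncomputable section

/-- The modified Jacobi theta function
`θ(z;p) = ∏_{j ≥ 0} (1 - z p^j) (1 - p^(j+1) / z)`, for `‖p‖ < 1` and `z ≠ 0`. -/
def ellTheta (z p : ℂ) : ℂ :=
  ∏' j : ℕ, (1 - z * p ^ j) * (1 - p ^ (j + 1) / z)

/-- The elliptic `q`-shifted factorial `(a;q,p)_n = ∏_{j=0}^{n-1} θ(a q^j;p)`. -/
def ellFac (a q p : ℂ) (n : ℕ) : ℂ :=
  ∏ j ∈ Finset.range n, ellTheta (a * q ^ j) p

/-- The coefficient of `α_r` in the expression of `β_n` for an elliptic WP Bailey pair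
(used for `r ≤ n`). -/
def ellKernel (a k q p : ℂ) (n r : ℕ) : ℂ :=
  ellFac (k / a) q p (n - r) / ellFac q q p (n - r) *
    (ellFac k q p (n + r) / ellFac (a * q) q p (n + r))

/-- The coefficient of `β_r` in the expression of `α_n` for an elliptic WP Bailey pair
(used for `r ≤ n`). -/
def ellInvKernel (a k q p : ℂ) (n r : ℕ) : ℂ :=
  ellTheta (a * q ^ (2 * n)) p / ellTheta a p *
    (ellTheta (k * q ^ (2 * r)) p / ellTheta k p) *
    (ellFac (a / k) q p (n - r) / ellFac q q p (n - r)) *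
    (ellFac a q p (n + r) / ellFac (k * q) q p (n + r)) *
    (k / a) ^ (n - r)

/-- `(α, β)` is an elliptic WP Bailey pair at the parameters `(a, k; q, p)`: both relations
of the elliptic WP Bailey transform hold. -/
def IsEllipticWPBaileyPair (a k q p : ℂ) (α β : ℕ → ℂ) : Prop :=
  (∀ n, β n = ∑ r ∈ Finset.range (n + 1), ellKernel a k q p n r * α r) ∧
  (∀ n, α n = ∑ r ∈ Finset.range (n + 1), ellInvKernel a k q p n r * β r)

/-- No denominator vanishes in the two relations which define an elliptic WP Bailey pair at
`(a, k; q, p)`; these denominators are `a`, `k`, `θ(a;p)`, `θ(k;p)` and the factorials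
`(q;q,p)_n`, `(aq;q,p)_n`, `(kq;q,p)_n`. -/
def EllipticRegular (a k q p : ℂ) : Prop :=
  a ≠ 0 ∧ k ≠ 0 ∧ q ≠ 0 ∧ ellTheta a p ≠ 0 ∧ ellTheta k p ≠ 0 ∧
    ∀ n, ellFac q q p n ≠ 0 ∧ ellFac (a * q) q p n ≠ 0 ∧ ellFac (k * q) q p n ≠ 0

/-- The coefficient of `β_r(a,m;q,p)` in the new sequence `β'_n(a²,k;q²,p²)`
(used for `r ≤ n`). -/
def ellQuadCoeff (a k m q p : ℂ) (n r : ℕ) : ℂ :=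
  ellFac (-(m * q)) q p (2 * n) / ellFac (-(a * q)) q p (2 * n) *
    (ellTheta (m * q ^ (2 * r)) p / ellTheta m p) *
    (ellFac (k / m ^ 2) (q ^ 2) (p ^ 2) (n - r) / ellFac (q ^ 2) (q ^ 2) (p ^ 2) (n - r)) *
    (ellFac k (q ^ 2) (p ^ 2) (n + r) / ellFac (m ^ 2 * q ^ 2) (q ^ 2) (p ^ 2) (n + r)) *
    (m / a) ^ (n - r)

/-- The `q`-shifted factorial `(a;q)_n = ∏_{j=0}^{n-1} (1 - a q^j)`. -/
def basicFac (a q : ℂ) (n : ℕ) : ℂ :=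
  ∏ j ∈ Finset.range n, (1 - a * q ^ j)

/-- The coefficient of `α_r` in the expression of `β_n` for a WP Bailey pair. -/
def basicKernel (a k q : ℂ) (n r : ℕ) : ℂ :=
  basicFac (k / a) q (n - r) / basicFac q q (n - r) *
    (basicFac k q (n + r) / basicFac (a * q) q (n + r))

/-- The coefficient of `β_r` in the expression of `α_n` for a WP Bailey pair. -/
def basicInvKernel (a k q : ℂ) (n r : ℕ) : ℂ :=
  (1 - a * q ^ (2 * n)) / (1 - a) * ((1 - k * q ^ (2 * r)) / (1 - k)) *
    (basicFac (a / k) q (n - r) / basicFac q q (n - r)) *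
    (basicFac a q (n + r) / basicFac (k * q) q (n + r)) *
    (k / a) ^ (n - r)

/-- `(α, β)` is a (basic) WP Bailey pair at the parameters `(a, k; q)`. -/
def IsWPBaileyPair (a k q : ℂ) (α β : ℕ → ℂ) : Prop :=
  (∀ n, β n = ∑ r ∈ Finset.range (n + 1), basicKernel a k q n r * α r) ∧
  (∀ n, α n = ∑ r ∈ Finset.range (n + 1), basicInvKernel a k q n r * β r)

/-- No denominator vanishes in the two relations which define a WP Bailey pair at
`(a, k; q)`. -/
def BasicRegular (a k q : ℂ) : Prop :=
  a ≠ 0 ∧ k ≠ 0 ∧ q ≠ 0 ∧ 1 - a ≠ 0 ∧ 1 - k ≠ 0 ∧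
    ∀ n, basicFac q q n ≠ 0 ∧ basicFac (a * q) q n ≠ 0 ∧ basicFac (k * q) q n ≠ 0

/-- The coefficient of `β_r(a,m;q)` in the new sequence `β'_n(a²,k;q²)`. -/
def basicQuadCoeff (a k m q : ℂ) (n r : ℕ) : ℂ :=
  basicFac (-(m * q)) q (2 * n) / basicFac (-(a * q)) q (2 * n) *
    ((1 - m * q ^ (2 * r)) / (1 - m)) *
    (basicFac (k / m ^ 2) (q ^ 2) (n - r) / basicFac (q ^ 2) (q ^ 2) (n - r)) *
    (basicFac k (q ^ 2) (n + r) / basicFac (m ^ 2 * q ^ 2) (q ^ 2) (n + r)) *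
    (m / a) ^ (n - r)

end

/-! Both relations of a WP Bailey pair are multiplications by lower triangular matrices, so the
theorem reduces to two matrix identities. Substituting the first relation at `(a, m; q, p)` into the
formula for `β'` shows that the new first relation follows from: the matrix of quadratic
coefficients times the kernel at `(a, m; q, p)` is the kernel at `(a², k; q², p²)`
(`sum_ellQuadCoeff_mul_ellKernel`). The second relation then follows because the two matrices at
`(a², k; q², p²)` are inverse to each other (`sum_ellInvKernel_mul_ellKernel`).

Each entry of these matrix products is an instance of the Frenkel-Turaev sum (`frenkelTuraev_sum`),
with balancing condition `b c d = e`. For the inverse matrices `b c = 1`, so the value contains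
`θ(1;p) = 0` off the diagonal. For the quadratic identity, `θ(x²;p²) = θ(x;p) θ(-x;p)` rewrites all
factorials to base `q²` in base `q`; with `κ² = k` the parameters are `c = κ/m`, `d = -κ/m`, `e =
-q`, and balancing is exactly `m = k/(aq)`.

The Frenkel-Turaev sum is proved by induction on its length. Weierstrass' three-term relation splits
each summand into two pieces, each a multiple of a summand of a shorter sum with shifted parameters;
the product side obeys the same recurrence by another case of that relation. The relation itself
comes from the Jacobi triple product: multiplying two theta series and sorting by parity writes
`θ(st) θ(s/t)`, up to a monomial factor, as a 2×2 determinant, and such determinants satisfy the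
Plücker relation. -/

/-! ### Theta series and products of two of them -/

theorem ellTheta_one (p : ℂ) : ellTheta 1 p = 0 :=
  tprod_of_exists_eq_zero ⟨0, by simp⟩

theorem ellTheta_zero_right (z : ℂ) : ellTheta z 0 = 1 - z := by
  rw [ellTheta, tprod_eq_mulSingle 0]
  · simp
  · intro j hj
    simp [hj]

/-- The coefficient `p ^ (k choose 2)` of the theta series. -/
noncomputable def thetaCoeff (p : ℂ) (k : ℤ) : ℂ := p ^ (k * (k - 1) / 2)

theorem two_mul_triangle (k : ℤ) : 2 * (k * (k - 1) / 2) = k * (k - 1) :=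
  Int.mul_ediv_cancel' (Int.even_mul_pred_self k).two_dvd

theorem thetaCoeff_add_one {p : ℂ} (hp : p ≠ 0) (k : ℤ) :
    thetaCoeff p (k + 1) = p ^ k * thetaCoeff p k := by
  rw [thetaCoeff, thetaCoeff, ← zpow_add₀ hp]
  congr 1
  have h1 := two_mul_triangle (k + 1)
  have h2 := two_mul_triangle k
  linarith

theorem thetaCoeff_one_sub (p : ℂ) (k : ℤ) : thetaCoeff p (1 - k) = thetaCoeff p k := by
  rw [thetaCoeff, thetaCoeff]
  congr 2
  ring

theorem thetaCoeff_ne_zero {p : ℂ} (hp : p ≠ 0) (k : ℤ) : thetaCoeff p k ≠ 0 :=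
  zpow_ne_zero _ hp

theorem summable_thetaCoeff {p y : ℂ} (hp : ‖p‖ < 1) (hp0 : p ≠ 0) (hy : y ≠ 0) :
    Summable fun k : ℤ => thetaCoeff p k * y ^ k := by
  have hne (k : ℤ) : thetaCoeff p k * y ^ k ≠ 0 :=
    mul_ne_zero (thetaCoeff_ne_zero hp0 k) (zpow_ne_zero k hy)
  have hpow : Tendsto (fun n : ℕ => ‖p‖ ^ n) atTop (𝓝 0) :=
    tendsto_pow_atTop_nhds_zero_of_lt_one (norm_nonneg _) hp
  -- Ratio test in both directions: the ratios of consecutive terms have norms `‖p‖ ^ n * ‖y‖` and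
  -- `‖p‖ ^ (n + 1) * ‖y⁻¹‖`.
  refine Summable.of_nat_of_neg
    (summable_of_ratio_test_tendsto_lt_one zero_lt_one (.of_forall fun n => hne n) ?_)
    (summable_of_ratio_test_tendsto_lt_one zero_lt_one (.of_forall fun n => hne (-n)) ?_)
  · have : Tendsto (fun n : ℕ => ‖p‖ ^ n * ‖y‖) atTop (𝓝 0) := by
      simpa using hpow.mul_const ‖y‖
    refine this.congr fun n => ?_
    rw [eq_div_iff (norm_ne_zero_iff.mpr (hne n)), ← norm_pow, ← norm_mul, ← norm_mul]
    push_cast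
    rw [thetaCoeff_add_one hp0, zpow_add_one₀ hy, zpow_natCast, zpow_natCast]
    ring_nf
  · have : Tendsto (fun n : ℕ => ‖p‖ ^ (n + 1) * ‖y⁻¹‖) atTop (𝓝 0) := by
      simpa using ((tendsto_add_atTop_iff_nat 1).mpr hpow).mul_const ‖y⁻¹‖
    refine this.congr fun n => ?_
    rw [eq_div_iff (norm_ne_zero_iff.mpr (hne (-n))), ← norm_pow, ← norm_mul, ← norm_mul]
    push_cast
    have e : -(n : ℤ) = -((n + 1 : ℕ) : ℤ) + 1 := by push_cast; ring
    rw [e, thetaCoeff_add_one hp0, zpow_add_one₀ hy, zpow_neg, zpow_natCast, ← Nat.cast_add_one]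
    have := pow_ne_zero (n + 1) hp0
    congr 1
    field_simp

/-- The theta series `∑ p ^ (k choose 2) y ^ k`. -/
noncomputable def thetaSeries (p y : ℂ) : ℂ := ∑' k : ℤ, thetaCoeff p k * y ^ k

theorem thetaSeries_inv {p y : ℂ} (hy : y ≠ 0) :
    thetaSeries p y⁻¹ = thetaSeries p y / y := by
  rw [thetaSeries, ← (Equiv.subLeft (1 : ℤ)).tsum_eq, thetaSeries, ← tsum_div_const]
  refine tsum_congr fun k => ?_
  rw [Equiv.subLeft_apply, thetaCoeff_one_sub, inv_zpow, ← zpow_neg, neg_sub, zpow_sub_one₀ hy]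
  ring

theorem thetaSeries_mul {p y : ℂ} (hp : p ≠ 0) (hy : y ≠ 0) :
    thetaSeries p (p * y) = thetaSeries p y / y := by
  rw [thetaSeries, thetaSeries, ← (Equiv.addRight (1 : ℤ)).tsum_eq fun k => thetaCoeff p k * y ^ k,
    ← tsum_div_const]
  refine tsum_congr fun k => ?_
  rw [Equiv.coe_addRight, thetaCoeff_add_one hp, mul_zpow, zpow_add_one₀ hy]
  field_simp

/-- The cross terms `uv` cancel in the sum of the two triangular exponents, which is `u(u - 1) +
v²`, so the variables separate. -/
theorem thetaCoeff_mul_even {p : ℂ} (hp : p ≠ 0) (u v : ℤ) :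
    thetaCoeff p (u + v) * thetaCoeff p (u - v) =
      thetaCoeff (p ^ 2) u * (thetaCoeff (p ^ 2) v * p ^ v) := by
  have h (k : ℤ) : thetaCoeff (p ^ 2) k = p ^ (k * (k - 1)) := by
    conv_rhs => rw [← two_mul_triangle, zpow_mul]
    rw [thetaCoeff]; norm_cast
  rw [h, h, thetaCoeff, thetaCoeff, ← zpow_add₀ hp, ← zpow_add₀ hp, ← zpow_add₀ hp]
  congr 1
  have h1 := two_mul_triangle (u + v)
  have h2 := two_mul_triangle (u - v)
  linarith

theorem thetaCoeff_mul_odd {p : ℂ} (hp : p ≠ 0) (u v : ℤ) :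
    thetaCoeff p (u + v + 1) * thetaCoeff p (u - v) =
      (thetaCoeff (p ^ 2) u * p ^ u) * (thetaCoeff (p ^ 2) v * (p ^ 2) ^ v) := by
  rw [thetaCoeff_add_one hp, mul_assoc, thetaCoeff_mul_even hp, zpow_add₀ hp,
    show (p ^ 2) ^ v = p ^ v * p ^ v by rw [sq, mul_zpow]]
  ring

/-- The decomposition of `ℤ × ℤ` according to the parity of the sum of the entries. -/
noncomputable def parityEquiv : (ℤ × ℤ) ⊕ (ℤ × ℤ) ≃ ℤ × ℤ :=
  Equiv.ofBijective
    (Sum.elim (fun x => (x.1 + x.2, x.1 - x.2)) (fun x => (x.1 + x.2 + 1, x.1 - x.2))) <| by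
    constructor
    · rintro (⟨a, b⟩ | ⟨a, b⟩) (⟨c, d⟩ | ⟨c, d⟩) h <;>
        simp only [Sum.elim_inl, Sum.elim_inr, Prod.mk.injEq] at h
      · rw [show a = c by omega, show b = d by omega]
      · omega
      · omega
      · rw [show a = c by omega, show b = d by omega]
    · rintro ⟨m, n⟩
      rcases Int.even_or_odd' (m + n) with ⟨k, hk | hk⟩
      · exact ⟨Sum.inl (k, k - n), by simp; omega⟩
      · exact ⟨Sum.inr (k, k - n), by simp; omega⟩

theorem parityEquiv_inl (u v : ℤ) : parityEquiv (.inl (u, v)) = (u + v, u - v) := rfl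

theorem parityEquiv_inr (u v : ℤ) : parityEquiv (.inr (u, v)) = (u + v + 1, u - v) := rfl

/-- In the double series, the index pairs of even sum are `(u + v, u - v)` and those of odd sum `(u
+ v + 1, u - v)`; on each class the summand factors into a function of `u` times a function of `v`.
-/
theorem thetaSeries_mul_thetaSeries {p s t : ℂ} (hp : ‖p‖ < 1) (hp0 : p ≠ 0) (hs : s ≠ 0)
    (ht : t ≠ 0) :
    thetaSeries p s * thetaSeries p t =
      thetaSeries (p ^ 2) (s * t) * thetaSeries (p ^ 2) (p * (s / t)) +
        t * (thetaSeries (p ^ 2) (p * (s * t)) * thetaSeries (p ^ 2) (s / t)) := by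
  have hp2 : ‖p ^ 2‖ < 1 := by
    rw [norm_pow]; exact pow_lt_one₀ (norm_nonneg _) hp two_ne_zero
  have hp20 : p ^ 2 ≠ 0 := pow_ne_zero 2 hp0
  have S1 := (summable_thetaCoeff hp hp0 hs).norm
  have S2 := (summable_thetaCoeff hp hp0 ht).norm
  have hst := mul_ne_zero hs ht
  have hst' := div_ne_zero hs ht
  have S3 := (summable_thetaCoeff hp2 hp20 hst).norm
  have S4 := (summable_thetaCoeff hp2 hp20 (mul_ne_zero hp0 hst')).norm
  have S5 := (summable_thetaCoeff hp2 hp20 (mul_ne_zero hp0 hst)).norm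
  have S6 := (summable_thetaCoeff hp2 hp20 (mul_ne_zero hp20 hst')).norm
  -- The odd class naturally yields the right-hand form; quasi-periodicity relates it to the stated
  -- one.
  have e6 : t * (thetaSeries (p ^ 2) (p * (s * t)) * thetaSeries (p ^ 2) (s / t)) =
      s * (thetaSeries (p ^ 2) (p * (s * t)) * thetaSeries (p ^ 2) (p ^ 2 * (s / t))) := by
    rw [thetaSeries_mul hp20 hst']
    field_simp
  rw [e6]
  simp only [thetaSeries]
  have heven (x : ℤ × ℤ) : thetaCoeff p (parityEquiv (.inl x)).1 * s ^ (parityEquiv (.inl x)).1 *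
        (thetaCoeff p (parityEquiv (.inl x)).2 * t ^ (parityEquiv (.inl x)).2) =
      thetaCoeff (p ^ 2) x.1 * (s * t) ^ x.1 *
        (thetaCoeff (p ^ 2) x.2 * (p * (s / t)) ^ x.2) := by
    obtain ⟨u, v⟩ := x
    simp only [parityEquiv_inl]
    have := thetaCoeff_mul_even hp0 u v
    rw [mul_zpow, mul_zpow, div_zpow, zpow_add₀ hs, zpow_sub₀ ht]
    linear_combination (s ^ u * s ^ v * (t ^ u / t ^ v)) * this
  have hodd (x : ℤ × ℤ) : thetaCoeff p (parityEquiv (.inr x)).1 * s ^ (parityEquiv (.inr x)).1 *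
        (thetaCoeff p (parityEquiv (.inr x)).2 * t ^ (parityEquiv (.inr x)).2) =
      s * (thetaCoeff (p ^ 2) x.1 * (p * (s * t)) ^ x.1 *
        (thetaCoeff (p ^ 2) x.2 * (p ^ 2 * (s / t)) ^ x.2)) := by
    obtain ⟨u, v⟩ := x
    simp only [parityEquiv_inr]
    have := thetaCoeff_mul_odd hp0 u v
    rw [mul_zpow, mul_zpow, mul_zpow, div_zpow, zpow_add₀ hs, zpow_add₀ hs, zpow_sub₀ ht,
      zpow_one]
    linear_combination (s ^ u * s ^ v * s * (t ^ u / t ^ v)) * this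
  rw [tsum_mul_tsum_of_summable_norm S1 S2, tsum_mul_tsum_of_summable_norm S3 S4,
    tsum_mul_tsum_of_summable_norm S5 S6, ← tsum_mul_left]
  have T1 := summable_mul_of_summable_norm S3 S4
  have T2 := (summable_mul_of_summable_norm S5 S6).mul_left s
  rw [← parityEquiv.tsum_eq, Summable.tsum_sum (T1.congr ?_) (T2.congr ?_)]
  · exact congrArg₂ (· + ·) (tsum_congr fun x => (heven x)) (tsum_congr fun x => (hodd x))
  · exact fun x => (heven x).symm
  · exact fun x => (hodd x).symm

/-! ### The Jacobi triple product -/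

/-- The reciprocal of `(p;p)_m`, extended by zero to negative `m`. -/
noncomputable def invPoch (p : ℂ) (m : ℤ) : ℂ :=
  if 0 ≤ m then (∏ i ∈ Finset.range m.toNat, (1 - p ^ (i + 1)))⁻¹ else 0

theorem one_sub_pow_ne_zero {p : ℂ} (hp : ‖p‖ < 1) (i : ℕ) : 1 - p ^ (i + 1) ≠ 0 := by
  intro h
  have : ‖p ^ (i + 1)‖ < 1 := by
    rw [norm_pow]; exact pow_lt_one₀ (norm_nonneg _) hp (by omega)
  rw [← sub_eq_zero.mp h, norm_one] at this
  exact lt_irrefl _ this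

theorem invPoch_natCast (p : ℂ) (n : ℕ) :
    invPoch p n = (∏ i ∈ Finset.range n, (1 - p ^ (i + 1)))⁻¹ := by
  simp [invPoch]

theorem invPoch_pred {p : ℂ} (hp : ‖p‖ < 1) (m : ℤ) :
    invPoch p (m - 1) = (1 - p ^ m) * invPoch p m := by
  rcases lt_or_ge m 0 with hm | hm
  · rw [invPoch, invPoch, if_neg (by omega), if_neg (by omega), mul_zero]
  · obtain ⟨n, rfl⟩ := Int.eq_ofNat_of_zero_le hm
    cases n with
    | zero => simp [invPoch]
    | succ n =>
      rw [show ((n + 1 : ℕ) : ℤ) - 1 = n by push_cast; ring, invPoch_natCast, invPoch_natCast,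
        Finset.prod_range_succ, mul_inv, zpow_natCast, mul_left_comm,
        mul_inv_cancel₀ (one_sub_pow_ne_zero hp n), mul_one]

/-- The finite form of the Jacobi triple product. -/
theorem hasSum_finite_triple_product {p z : ℂ} (hp : ‖p‖ < 1) (hp0 : p ≠ 0) (hz : z ≠ 0) (n : ℕ) :
    HasSum (fun k : ℤ => (∏ i ∈ Finset.range (2 * n), (1 - p ^ (i + 1))) * invPoch p (n + k) *
        invPoch p (n - k) * (thetaCoeff p k * (-z) ^ k))
      (∏ j ∈ Finset.range n, ((1 - z * p ^ j) * (1 - p ^ (j + 1) / z))) := by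
  have hz' : -z ≠ 0 := neg_ne_zero.mpr hz
  induction n with
  | zero =>
    convert hasSum_single (0 : ℤ) ?_ using 1
    · simp [invPoch, thetaCoeff]
    · intro k hk
      rcases lt_or_gt_of_ne hk with h | h
      · simp [invPoch, not_le.mpr h]
      · simp [invPoch, not_le.mpr h]
  | succ n ih =>
    rw [Finset.prod_range_succ]
    -- The new factor expands to `1 + p^(2n+1) - z p^n - p^(n+1)/z`; its last two terms are absorbed
    -- by shifting the summation index by one in either direction.
    have h1 := (Equiv.subRight (1 : ℤ)).hasSum_iff.mpr ih
    have h2 := (Equiv.addRight (1 : ℤ)).hasSum_iff.mpr ih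
    have h3 := ((ih.mul_left (1 + p ^ (2 * n + 1))).add (h1.mul_left (-z * p ^ n))).add
      (h2.mul_left (-(p ^ (n + 1) / z)))
    rw [← add_mul, ← add_mul, show 1 + p ^ (2 * n + 1) + -z * p ^ n + -(p ^ (n + 1) / z) =
      (1 - z * p ^ n) * (1 - p ^ (n + 1) / z) by field_simp; ring,
      mul_comm (_ * (1 - p ^ (n + 1) / z))] at h3
    refine cast (congrArg (fun f : ℤ → ℂ => HasSum f _) (funext fun k => Eq.symm ?_)) h3
    simp only [Function.comp_apply, Equiv.subRight_apply, Equiv.coe_addRight]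
    have a1 : invPoch p (n + k) =
        (1 - p * p ^ (n + k : ℤ)) * invPoch p ((n + 1 : ℕ) + k) := by
      rw [← zpow_one_add₀ hp0, show (1 + (n + k) : ℤ) = (n + 1 : ℕ) + k by push_cast; ring,
        ← invPoch_pred hp]
      congr 1; push_cast; ring
    have a2 : invPoch p (n - k) =
        (1 - p * p ^ (n - k : ℤ)) * invPoch p ((n + 1 : ℕ) - k) := by
      rw [← zpow_one_add₀ hp0, show (1 + (n - k) : ℤ) = (n + 1 : ℕ) - k by push_cast; ring,
        ← invPoch_pred hp]
      congr 1; push_cast; ring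
    have a3 : invPoch p (n + (k - 1)) = (1 - p ^ (n + k : ℤ)) * invPoch p (n + k) := by
      rw [← invPoch_pred hp]; congr 1; ring
    have a4 : invPoch p (n - (k + 1)) = (1 - p ^ (n - k : ℤ)) * invPoch p (n - k) := by
      rw [← invPoch_pred hp]; congr 1; ring
    have a5 : invPoch p (n - (k - 1)) = invPoch p ((n + 1 : ℕ) - k) := by
      congr 1; push_cast; ring
    have a6 : invPoch p (n + (k + 1)) = invPoch p ((n + 1 : ℕ) + k) := by
      congr 1; push_cast; ring
    have b1 : thetaCoeff p (k - 1) * (-z) ^ (k - 1) * (-z * p ^ n) =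
        p * p ^ (n - k : ℤ) * (thetaCoeff p k * (-z) ^ k) := by
      have := thetaCoeff_add_one hp0 (k - 1)
      rw [sub_add_cancel] at this
      rw [this, zpow_sub_one₀ hz', zpow_sub_one₀ hp0, zpow_sub₀ hp0, zpow_natCast]
      have := zpow_ne_zero k hp0
      field_simp
    have b2 : thetaCoeff p (k + 1) * (-z) ^ (k + 1) * (-(p ^ (n + 1) / z)) =
        p * p ^ (n + k : ℤ) * (thetaCoeff p k * (-z) ^ k) := by
      rw [thetaCoeff_add_one hp0, zpow_add_one₀ hz', zpow_add₀ hp0, zpow_natCast]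
      field_simp
      ring
    have c1 : p ^ (2 * n) = p ^ (n + k : ℤ) * p ^ (n - k : ℤ) := by
      rw [← zpow_add₀ hp0, ← zpow_natCast]; congr 1; push_cast; ring
    have c2 : ∏ i ∈ Finset.range (2 * (n + 1)), (1 - p ^ (i + 1)) =
        (∏ i ∈ Finset.range (2 * n), (1 - p ^ (i + 1))) * (1 - p * p ^ (2 * n)) *
          (1 - p ^ 2 * p ^ (2 * n)) := by
      rw [show 2 * (n + 1) = 2 * n + 1 + 1 by ring, Finset.prod_range_succ,
        Finset.prod_range_succ]
      ring
    -- With everything expressed through `u = p^(n+k)` and `v = p^(n-k)`, the Pascal-type recurrence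
    -- of the coefficients is a polynomial identity.
    rw [a3, a4, a5, a6, a1, a2, c2, pow_succ p (2 * n), c1]
    generalize invPoch p ((n + 1 : ℕ) + k) = R at *
    generalize invPoch p ((n + 1 : ℕ) - k) = S at *
    generalize p ^ (n + k : ℤ) = u at *
    generalize p ^ (n - k : ℤ) = v at *
    generalize ∏ i ∈ Finset.range (2 * n), (1 - p ^ (i + 1)) = Q at *
    linear_combination (-Q * (1 - u) * (1 - p * u) * R * S) * b1 -
      (Q * (1 - v) * (1 - p * v) * R * S) * b2

theorem summable_norm_pow_succ {p : ℂ} (hp : ‖p‖ < 1) : Summable fun i : ℕ => ‖p ^ (i + 1)‖ := by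
  simp only [norm_pow]
  exact (summable_nat_add_iff 1).mpr (summable_geometric_of_lt_one (norm_nonneg _) hp)

theorem multipliable_ellTheta {p : ℂ} (hp : ‖p‖ < 1) (z : ℂ) :
    Multipliable fun j : ℕ => (1 - z * p ^ j) * (1 - p ^ (j + 1) / z) := by
  have h1 : Summable fun j : ℕ => ‖-(z * p ^ j)‖ := by
    simp only [norm_neg, norm_mul, norm_pow]
    exact (summable_geometric_of_lt_one (norm_nonneg _) hp).mul_left _
  have h2 : Summable fun j : ℕ => ‖-(p ^ (j + 1) / z)‖ := by
    simp only [norm_neg, norm_div]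
    exact (summable_norm_pow_succ hp).div_const _
  simpa only [← sub_eq_add_neg] using
    (multipliable_one_add_of_summable h1).mul (multipliable_one_add_of_summable h2)

/-- The Jacobi triple product, up to a constant. -/
theorem exists_ellTheta_eq_thetaSeries {p : ℂ} (hp : ‖p‖ < 1) (hp0 : p ≠ 0) :
    ∃ C : ℂ, C ≠ 0 ∧ ∀ z : ℂ, z ≠ 0 → ellTheta z p = C * thetaSeries p (-z) := by
  have hs : Summable fun i : ℕ => ‖-p ^ (i + 1)‖ := by
    simpa only [norm_neg] using summable_norm_pow_succ hp
  set D : ℂ := ∏' i : ℕ, (1 + -p ^ (i + 1)) with hD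
  have hD0 : D ≠ 0 := tprod_one_add_ne_zero_of_summable
    (fun i => by simpa [sub_eq_add_neg] using one_sub_pow_ne_zero hp i) hs
  set P : ℕ → ℂ := fun n => ∏ i ∈ Finset.range n, (1 - p ^ (i + 1)) with hP
  have hlim : Tendsto P atTop (𝓝 D) :=
    (multipliable_one_add_of_summable hs).hasProd.tendsto_prod_nat.congr fun n =>
      Finset.prod_congr rfl fun i _ => (sub_eq_add_neg _ _).symm
  have hlim' : Tendsto (fun n => (P n)⁻¹) atTop (𝓝 D⁻¹) := hlim.inv₀ hD0
  -- Convergent sequences are bounded; `M * N * N` times the norms of the theta series terms is the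
  -- dominating series below.
  obtain ⟨M, hM⟩ := (Metric.isBounded_range_of_tendsto P hlim).exists_norm_le
  obtain ⟨N, hN⟩ := (Metric.isBounded_range_of_tendsto _ hlim').exists_norm_le
  have hM' (n : ℕ) : ‖P n‖ ≤ M := hM _ ⟨n, rfl⟩
  have hN' (m : ℤ) : ‖invPoch p m‖ ≤ N := by
    rw [invPoch]
    split_ifs
    · exact hN _ ⟨_, rfl⟩
    · simpa using (norm_nonneg _).trans (hN _ ⟨0, rfl⟩)
  have hr (f : ℕ → ℤ) (hf : Tendsto f atTop atTop) :
      Tendsto (fun n => invPoch p (f n)) atTop (𝓝 D⁻¹) := by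
    have h1 : Tendsto (fun n => (f n).toNat) atTop atTop := by
      refine tendsto_atTop.mpr fun b => ?_
      filter_upwards [hf.eventually_ge_atTop (b : ℤ)] with n hn
      omega
    refine (hlim'.comp h1).congr' ?_
    filter_upwards [hf.eventually_ge_atTop 0] with n hn
    simp [invPoch, hn, hP]
  -- As `n → ∞` the coefficient `(p;p)_{2n} / ((p;p)_{n+k} (p;p)_{n-k})` tends to `D / D²`. The
  -- exact constant is irrelevant later, since the theta relations are homogeneous.
  refine ⟨D⁻¹, inv_ne_zero hD0, fun z hz => ?_⟩
  have hsum := summable_thetaCoeff hp hp0 (neg_ne_zero.mpr hz)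
  have L1 := (multipliable_ellTheta hp z).hasProd.tendsto_prod_nat
  have L2 : Tendsto (fun n : ℕ => ∑' k : ℤ, P (2 * n) * invPoch p (n + k) *
        invPoch p (n - k) * (thetaCoeff p k * (-z) ^ k)) atTop
      (𝓝 (∑' k : ℤ, D * D⁻¹ * D⁻¹ * (thetaCoeff p k * (-z) ^ k))) := by
    refine tendsto_tsum_of_dominated_convergence (hsum.norm.mul_left (M * N * N)) ?_ ?_
    · intro k
      refine (((hlim.comp (tendsto_id.const_mul_atTop' two_pos)).mul (hr _ ?_)).mul
        (hr _ ?_)).mul_const _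
      · exact tendsto_atTop_add_const_right _ _ tendsto_natCast_atTop_atTop
      · simp only [sub_eq_add_neg]
        exact tendsto_atTop_add_const_right _ _ tendsto_natCast_atTop_atTop
    · refine .of_forall fun n k => ?_
      rw [norm_mul, norm_mul, norm_mul]
      have hM0 : 0 ≤ M := (norm_nonneg _).trans (hM' 0)
      have hN0 : 0 ≤ N := (norm_nonneg _).trans (hN' 0)
      gcongr
      · exact hM' _
      · exact hN' _
      · exact hN' _
  rw [mul_inv_cancel₀ hD0, one_mul, tsum_mul_left] at L2
  refine tendsto_nhds_unique L1 (L2.congr fun n => ?_)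
  exact (hasSum_finite_triple_product hp hp0 hz n).tsum_eq

/-! ### Weierstrass' relation and its specializations -/

theorem ellTheta_inv {z p : ℂ} (hp : ‖p‖ < 1) (hz : z ≠ 0) :
    ellTheta z⁻¹ p = -ellTheta z p / z := by
  rcases eq_or_ne p 0 with rfl | hp0
  · rw [ellTheta_zero_right, ellTheta_zero_right]
    field_simp
    ring
  · obtain ⟨C, -, h⟩ := exists_ellTheta_eq_thetaSeries hp hp0
    rw [h _ (inv_ne_zero hz), h _ hz, ← inv_neg, thetaSeries_inv (neg_ne_zero.mpr hz)]
    field_simp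

/-- By `key`, `θ(st) θ(s/t)` is `C² s` times the determinant of two vectors depending on `s` and on
`t` alone. The relation is the Plücker identity for the four vectors at `x, y, u, v`. -/
theorem ellTheta_weierstrass {p : ℂ} (hp : ‖p‖ < 1) {x y u v : ℂ}
    (hx : x ≠ 0) (hy : y ≠ 0) (hu : u ≠ 0) (hv : v ≠ 0) :
    y * (ellTheta (x * y) p * ellTheta (x / y) p * (ellTheta (u * v) p * ellTheta (u / v) p))
      - u * (ellTheta (x * u) p * ellTheta (x / u) p * (ellTheta (y * v) p * ellTheta (y / v) p))
      + u * (ellTheta (x * v) p * ellTheta (x / v) p * (ellTheta (y * u) p * ellTheta (y / u) p))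
      = 0 := by
  rcases eq_or_ne p 0 with rfl | hp0
  · simp only [ellTheta_zero_right]
    field_simp
    ring
  · obtain ⟨C, -, h⟩ := exists_ellTheta_eq_thetaSeries hp hp0
    have key (s t : ℂ) (hs : s ≠ 0) (ht : t ≠ 0) : ellTheta (s * t) p * ellTheta (s / t) p =
        C ^ 2 * (thetaSeries (p ^ 2) (s ^ 2) * thetaSeries (p ^ 2) (p * t ^ 2) -
          s / t * (thetaSeries (p ^ 2) (p * s ^ 2) * thetaSeries (p ^ 2) (t ^ 2))) := by
      rw [h _ (mul_ne_zero hs ht), h _ (div_ne_zero hs ht), mul_mul_mul_comm,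
        thetaSeries_mul_thetaSeries hp hp0 (neg_ne_zero.mpr (mul_ne_zero hs ht))
          (neg_ne_zero.mpr (div_ne_zero hs ht)), show -(s * t) * -(s / t) = s ^ 2 by field_simp,
        show -(s * t) / -(s / t) = t ^ 2 by field_simp]
      ring
    rw [key _ _ hx hy, key _ _ hu hv, key _ _ hx hu, key _ _ hy hv, key _ _ hx hv, key _ _ hy hu]
    field_simp
    ring

/-- Weierstrass' relation at `tr, ts, tw, t` with `t² = a`: products contain only `t²` and quotients
lose `t`, so no square root survives. -/
theorem ellTheta_three_term {p : ℂ} (hp : ‖p‖ < 1) {a r s w : ℂ}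
    (ha : a ≠ 0) (hr : r ≠ 0) (hs : s ≠ 0) (hw : w ≠ 0) :
    s * (ellTheta (a * r * s) p * ellTheta (r / s) p * (ellTheta (a * w) p * ellTheta w p))
      - w * (ellTheta (a * r * w) p * ellTheta (r / w) p * (ellTheta (a * s) p * ellTheta s p))
      + w * (ellTheta (a * r) p * ellTheta r p * (ellTheta (a * s * w) p * ellTheta (s / w) p))
      = 0 := by
  obtain ⟨t, rfl⟩ := IsAlgClosed.exists_pow_nat_eq a (n := 2) (by norm_num)
  have ht : t ≠ 0 := by rintro rfl; simp at ha
  have h := ellTheta_weierstrass hp (mul_ne_zero ht hr) (mul_ne_zero ht hs) (mul_ne_zero ht hw) ht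
  rw [show t * r * (t * s) = t ^ 2 * r * s by ring, show t * r * (t * w) = t ^ 2 * r * w by ring,
    show t * s * (t * w) = t ^ 2 * s * w by ring, show t * r * t = t ^ 2 * r by ring,
    show t * s * t = t ^ 2 * s by ring, show t * w * t = t ^ 2 * w by ring,
    mul_div_mul_left r s ht, mul_div_mul_left r w ht, mul_div_mul_left s w ht,
    mul_div_cancel_left₀ r ht, mul_div_cancel_left₀ s ht, mul_div_cancel_left₀ w ht] at h
  apply mul_left_cancel₀ ht
  linear_combination h

/-- The case `r = exy`, `s = xy`, `w = y`. With `x = q^i`, `y = q^j` it splits the summands of the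
Frenkel-Turaev sum. -/
theorem ellTheta_term_identity {p : ℂ} (hp : ‖p‖ < 1) {a e x y : ℂ}
    (ha : a ≠ 0) (he : e ≠ 0) (hx : x ≠ 0) (hy : y ≠ 0) :
    ellTheta (e * (x * y)) p * ellTheta (a * e * (x * y)) p *
        (ellTheta x p * ellTheta (a * (x * y ^ 2)) p) +
      ellTheta e p * ellTheta (a * e * (x * y) ^ 2) p *
        (x * (ellTheta y p * ellTheta (a * y) p)) =
    ellTheta (x * y) p * ellTheta (a * (x * y)) p *
      (ellTheta (e * x) p * ellTheta (a * e * (x * y ^ 2)) p) := by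
  have h := ellTheta_three_term hp ha (mul_ne_zero he (mul_ne_zero hx hy)) (mul_ne_zero hx hy) hy
  rw [show a * (e * (x * y)) * (x * y) = a * e * (x * y) ^ 2 by ring,
    show e * (x * y) / (x * y) = e by field_simp,
    show a * (e * (x * y)) * y = a * e * (x * y ^ 2) by ring,
    show e * (x * y) / y = e * x by field_simp,
    show a * (e * (x * y)) = a * e * (x * y) by ring,
    show a * (x * y) * y = a * (x * y ^ 2) by ring,
    show x * y / y = x by field_simp] at h
  apply mul_left_cancel₀ hy
  linear_combination h

/-- The three-term relation with `cd, a, d⁻¹, b` in place of `a, r, s, w`, followed by inversion. It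
yields the recurrence of the Frenkel-Turaev values. -/
theorem ellTheta_sum_identity {p : ℂ} (hp : ‖p‖ < 1) {a b c d : ℂ}
    (ha : a ≠ 0) (hb : b ≠ 0) (hc : c ≠ 0) (hd : d ≠ 0) :
    ellTheta a p * ellTheta (b * c) p * ellTheta (b * d) p * ellTheta (a * c * d) p =
      b * ellTheta c p * ellTheta d p * ellTheta (a * b * c * d) p * ellTheta (a / b) p +
      ellTheta b p * ellTheta (b * c * d) p * ellTheta (a * c) p * ellTheta (a * d) p := by
  have h := ellTheta_three_term hp (mul_ne_zero hc hd) ha (inv_ne_zero hd) hb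
  rw [show c * d * a * d⁻¹ = a * c by field_simp,
    show a / d⁻¹ = a * d by field_simp,
    show c * d * b = b * c * d by ring,
    show c * d * a * b = a * b * c * d by ring,
    show c * d * d⁻¹ = c by field_simp, ellTheta_inv hp hd,
    show c * d * a = a * c * d by ring, show c * b = b * c by ring,
    show d⁻¹ / b = (b * d)⁻¹ by field_simp, ellTheta_inv hp (mul_ne_zero hb hd)] at h
  generalize ellTheta (a * c) p = t1, ellTheta (a * d) p = t2, ellTheta (b * c * d) p = t3,
    ellTheta (a * b * c * d) p = t4, ellTheta (a / b) p = t5, ellTheta (a * c * d) p = t6,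
    ellTheta (b * c) p = t7, ellTheta (b * d) p = t8 at h ⊢
  field_simp at h
  linear_combination -h

/-! ### Elliptic shifted factorials -/

theorem ellFac_zero (x q p : ℂ) : ellFac x q p 0 = 1 := by simp [ellFac]

theorem ellFac_succ (x q p : ℂ) (n : ℕ) :
    ellFac x q p (n + 1) = ellFac x q p n * ellTheta (x * q ^ n) p :=
  Finset.prod_range_succ _ _

theorem ellFac_succ' (x q p : ℂ) (n : ℕ) :
    ellFac x q p (n + 1) = ellTheta x p * ellFac (x * q) q p n := by
  rw [ellFac, Finset.prod_range_succ', mul_comm, ellFac]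
  simp [pow_succ', mul_assoc]

theorem ellFac_add (x q p : ℂ) (m n : ℕ) :
    ellFac x q p (m + n) = ellFac x q p m * ellFac (x * q ^ m) q p n := by
  rw [ellFac, Finset.prod_range_add, ellFac, ellFac]
  simp [pow_add, mul_assoc]

theorem ellFac_ne_zero {x q p : ℂ} {n : ℕ} (h : ∀ i < n, ellTheta (x * q ^ i) p ≠ 0) :
    ellFac x q p n ≠ 0 :=
  Finset.prod_ne_zero_iff.mpr fun i hi => h i (Finset.mem_range.mp hi)

theorem ellTheta_ne_zero_of_ellFac {x q p : ℂ} (h : ∀ n, ellFac x q p n ≠ 0) (i : ℕ) :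
    ellTheta (x * q ^ i) p ≠ 0 :=
  fun h0 => h (i + 1) (by rw [ellFac_succ, h0, mul_zero])

/-! ### The Frenkel-Turaev sum -/

/-- The skeleton of the induction: as in Pascal's triangle, interior terms split in two and each end
term feeds only one of the shorter sums. -/
theorem sum_antidiagonal_pascal {R : Type*} [AddCommMonoid R] (F G H : ℕ → ℕ → R) (n : ℕ)
    (hl : F (n + 1) 0 = G n 0) (hr : F 0 (n + 1) = H 0 n)
    (hm : ∀ i j, i + j + 1 = n → F (i + 1) (j + 1) = G i (j + 1) + H (i + 1) j) :
    ∑ x ∈ Finset.HasAntidiagonal.antidiagonal (n + 1), F x.1 x.2 =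
      ∑ x ∈ Finset.HasAntidiagonal.antidiagonal n, G x.1 x.2 + ∑ x ∈ Finset.HasAntidiagonal.antidiagonal n, H x.1 x.2 := by
  cases n with
  | zero => simpa [Finset.Nat.antidiagonal_succ, add_comm] using congrArg₂ (· + ·) hl hr
  | succ m =>
    rw [Finset.Nat.sum_antidiagonal_succ (f := fun x : ℕ × ℕ => F x.1 x.2),
      Finset.Nat.sum_antidiagonal_succ' (f := fun x : ℕ × ℕ => F (x.1 + 1) x.2),
      Finset.Nat.sum_antidiagonal_succ' (f := fun x : ℕ × ℕ => G x.1 x.2),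
      Finset.Nat.sum_antidiagonal_succ (f := fun x : ℕ × ℕ => H x.1 x.2)]
    simp only
    rw [hl, hr, Finset.sum_congr rfl fun x hx => hm x.1 x.2
      (by rw [Finset.HasAntidiagonal.mem_antidiagonal.mp hx]), Finset.sum_add_distrib]
    abel

/-- The summand, with `n = i + j`, of the Frenkel-Turaev sum. -/
noncomputable def frenkelTuraevTerm (a b c d e q p : ℂ) (i j : ℕ) : ℂ :=
  ellTheta (a * q ^ (2 * j)) p / ellTheta a p *
    (ellFac a q p j * ellFac b q p j / (ellFac q q p j * ellFac (a * q / b) q p j)) *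
    (ellFac c q p i * ellFac d q p i / (ellFac q q p i * ellFac e q p i)) *
    (ellFac (a * c) q p (i + 2 * j) * ellFac (a * d) q p (i + 2 * j) /
      (ellFac (a * q) q p (i + 2 * j) * ellFac (a * e) q p (i + 2 * j))) * b ^ i

/-- The value of the Frenkel-Turaev sum. -/
noncomputable def frenkelTuraevValue (a b c d e q p : ℂ) (n : ℕ) : ℂ :=
  ellFac (b * c) q p n * ellFac (b * d) q p n * ellFac (a * c) q p n * ellFac (a * d) q p n *
    ellFac (a * e / b * q ^ n) q p n /
    (ellFac q q p n * ellFac e q p n * ellFac (a * q / b) q p n * ellFac (a * e) q p (2 * n))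

/-- Nonvanishing of the denominators in the Frenkel-Turaev sum. -/
structure FrenkelTuraevRegular (a b e q p : ℂ) : Prop where
  q_ne (i : ℕ) : ellTheta (q * q ^ i) p ≠ 0
  a_ne (i : ℕ) : ellTheta (a * q ^ i) p ≠ 0
  e_ne (i : ℕ) : ellTheta (e * q ^ i) p ≠ 0
  ae_ne (i : ℕ) : ellTheta (a * e * q ^ i) p ≠ 0
  ab_ne (i : ℕ) : ellTheta (a * q / b * q ^ i) p ≠ 0

/-- The theta values at the shifted parameters are among the original ones, so the induction
hypothesis applies. -/
theorem FrenkelTuraevRegular.shift_left {a b e q p : ℂ} (h : FrenkelTuraevRegular a b e q p) :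
    FrenkelTuraevRegular a b (e * q ^ 2) q p where
  q_ne := h.q_ne
  a_ne := h.a_ne
  e_ne i := by convert h.e_ne (i + 2) using 2; ring
  ae_ne i := by convert h.ae_ne (i + 2) using 2; ring
  ab_ne := h.ab_ne

theorem FrenkelTuraevRegular.shift_right {a b e q p : ℂ} (hq : q ≠ 0)
    (h : FrenkelTuraevRegular a b e q p) :
    FrenkelTuraevRegular (a * q ^ 2) (b * q) (e * q) q p where
  q_ne := h.q_ne
  a_ne i := by convert h.a_ne (i + 2) using 2; ring
  e_ne i := by convert h.e_ne (i + 1) using 2; ring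
  ae_ne i := by convert h.ae_ne (i + 3) using 2; ring
  ab_ne i := by
    convert h.ab_ne (i + 1) using 2
    rw [show a * q ^ 2 * q / (b * q) = a * q / b * q * (q / q) by ring, div_self hq]; ring

/-- The factors built from `c, d, e` and those built from `ac, ad, ae` have the same shape, so this
cancellation serves both. -/
theorem frenkelTuraev_left_aux (c d s1 s2 X1 X6 C D : ℂ) {s5 s7 : ℂ} (h5 : s5 ≠ 0) (h7 : s7 ≠ 0) :
    c * d / (s1 * s2) * (C * D / (X1 * X6)) =
      c * C * (d * D) / (X1 * s7 * (s1 * (s2 * X6) / s5)) * (s7 / s5) := by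
  rw [div_mul_div_comm, div_mul_div_comm, show X1 * s7 * (s1 * (s2 * X6) / s5) * s5 =
    (s1 * s2 * (X1 * X6)) * s7 * (s5 / s5) by ring, div_self h5, mul_one, mul_div_mul_right _ _ h7]
  ring

/-- Identifies the first piece of a split summand as a multiple of a summand with `c, d, e` moved to
`cq, dq, eq²`; the multiplier is independent of `i` and `j`. -/
theorem frenkelTuraevTerm_left {a b c d e q p : ℂ} 
    (h : FrenkelTuraevRegular a b e q p) (i j : ℕ) :
    b * ellTheta c p * ellTheta (a * c) p * ellTheta d p * ellTheta (a * d) p /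
        (ellTheta e p * ellTheta (e * q) p * ellTheta (a * e) p * ellTheta (a * e * q) p) *
      frenkelTuraevTerm a b (c * q) (d * q) (e * q ^ 2) q p i j =
    frenkelTuraevTerm a b c d e q p (i + 1) j *
      (ellTheta (q ^ (i + 1)) p * ellTheta (a * q ^ (i + 1 + 2 * j)) p /
        (ellTheta (e * q ^ (i + 1)) p * ellTheta (a * e * q ^ (i + 1 + 2 * j)) p)) := by
  have hc := ellFac_succ' c q p i
  have hd := ellFac_succ' d q p i
  have hac := ellFac_succ' (a * c) q p (i + 2 * j)
  have had := ellFac_succ' (a * d) q p (i + 2 * j)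
  have hqi := ellFac_succ q q p i
  have haq := ellFac_succ (a * q) q p (i + 2 * j)
  have he : ellFac e q p (i + 1) * ellTheta (e * q ^ (i + 1)) p =
      ellTheta e p * (ellTheta (e * q) p * ellFac (e * q ^ 2) q p i) := by
    rw [← ellFac_succ, ellFac_succ', ellFac_succ', show e * q * q = e * q ^ 2 by ring]
  have hae : ellFac (a * e) q p (i + 2 * j + 1) * ellTheta (a * e * q ^ (i + 2 * j + 1)) p =
      ellTheta (a * e) p * (ellTheta (a * e * q) p *
        ellFac (a * (e * q ^ 2)) q p (i + 2 * j)) := by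
    rw [← ellFac_succ, ellFac_succ', ellFac_succ', show a * e * q * q = a * (e * q ^ 2) by ring]
  have t1 := h.e_ne (i + 1)
  have t2 := h.ae_ne (i + 2 * j + 1)
  have t7 := h.q_ne i
  have t8 : ellTheta (a * q ^ (i + 2 * j + 1)) p ≠ 0 := h.a_ne _
  have e3 : q * q ^ i = q ^ (i + 1) := by ring
  have e4 : a * q * q ^ (i + 2 * j) = a * q ^ (i + 2 * j + 1) := by ring
  rw [e3] at hqi t7
  rw [e4] at haq
  rw [frenkelTuraevTerm, frenkelTuraevTerm, show a * (c * q) = a * c * q by ring,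
    show a * (d * q) = a * d * q by ring, show i + 1 + 2 * j = i + 2 * j + 1 by ring,
    hc, hd, hac, had, hqi, haq, eq_div_of_mul_eq t1 he, eq_div_of_mul_eq t2 hae]
  have p1 := frenkelTuraev_left_aux (ellTheta c p) (ellTheta d p) (ellTheta e p)
    (ellTheta (e * q) p) (ellFac q q p i) (ellFac (e * q ^ 2) q p i)
    (ellFac (c * q) q p i) (ellFac (d * q) q p i) t1 t7
  have p2 := frenkelTuraev_left_aux (ellTheta (a * c) p) (ellTheta (a * d) p) (ellTheta (a * e) p)
    (ellTheta (a * e * q) p) (ellFac (a * q) q p (i + 2 * j))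
    (ellFac (a * (e * q ^ 2)) q p (i + 2 * j))
    (ellFac (a * c * q) q p (i + 2 * j)) (ellFac (a * d * q) q p (i + 2 * j)) t2 t8
  generalize ellTheta (a * q ^ (2 * j)) p / ellTheta a p *
    (ellFac a q p j * ellFac b q p j / (ellFac q q p j * ellFac (a * q / b) q p j)) = X
  calc
    _ = b * X * b ^ i * (ellTheta c p * ellTheta d p / (ellTheta e p * ellTheta (e * q) p) *
          (ellFac (c * q) q p i * ellFac (d * q) q p i /
            (ellFac q q p i * ellFac (e * q ^ 2) q p i))) *
        (ellTheta (a * c) p * ellTheta (a * d) p / (ellTheta (a * e) p * ellTheta (a * e * q) p) *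
          (ellFac (a * c * q) q p (i + 2 * j) * ellFac (a * d * q) q p (i + 2 * j) /
            (ellFac (a * q) q p (i + 2 * j) * ellFac (a * (e * q ^ 2)) q p (i + 2 * j)))) := by
      simp only [div_eq_mul_inv, mul_inv]; ring
    _ = _ := by rw [p1, p2]; simp only [div_eq_mul_inv, mul_inv]; ring

theorem frenkelTuraevTerm_right {a b c d e q p : ℂ} (hq : q ≠ 0)
    (h : FrenkelTuraevRegular a b e q p) (i j : ℕ) :
    ellTheta b p * ellTheta (a * c) p * ellTheta (a * c * q) p *
          ellTheta (a * d) p * ellTheta (a * d * q) p /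
        (ellTheta (a * q / b) p * ellTheta e p * ellTheta (a * e) p * ellTheta (a * e * q) p *
          ellTheta (a * e * q ^ 2) p) *
      frenkelTuraevTerm (a * q ^ 2) (b * q) c d (e * q) q p i j =
    frenkelTuraevTerm a b c d e q p i (j + 1) *
      (q ^ i * (ellTheta (q ^ (j + 1)) p * ellTheta (a * q ^ (j + 1)) p) /
        (ellTheta (e * q ^ i) p * ellTheta (a * e * q ^ (i + 2 * (j + 1))) p)) := by
  have hb := ellFac_succ' b q p j
  have hab := ellFac_succ' (a * q / b) q p j
  have hqj := ellFac_succ q q p j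
  have ha : ellFac a q p (j + 1) * ellTheta (a * q ^ (j + 1)) p =
      ellTheta a p * (ellTheta (a * q) p * ellFac (a * q ^ 2) q p j) := by
    rw [← ellFac_succ, ellFac_succ', ellFac_succ', show a * q * q = a * q ^ 2 by ring]
  have he : ellFac e q p i * ellTheta (e * q ^ i) p = ellTheta e p * ellFac (e * q) q p i := by
    rw [← ellFac_succ, ellFac_succ']
  have hae : ellFac (a * e) q p (i + 2 * j + 2) * ellTheta (a * e * q ^ (i + 2 * j + 2)) p =
      ellTheta (a * e) p * (ellTheta (a * e * q) p * (ellTheta (a * e * q ^ 2) p *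
        ellFac (a * q ^ 2 * (e * q)) q p (i + 2 * j))) := by
    rw [← ellFac_succ, ellFac_succ', ellFac_succ', ellFac_succ',
      show a * e * q * q = a * e * q ^ 2 by ring,
      show a * e * q ^ 2 * q = a * q ^ 2 * (e * q) by ring]
  have h2 (x : ℂ) : ellFac x q p (i + 2 * j + 2) =
      ellTheta x p * (ellTheta (x * q) p * ellFac (x * q ^ 2) q p (i + 2 * j)) := by
    rw [ellFac_succ', ellFac_succ', show x * q * q = x * q ^ 2 by ring]
  have t1 := h.e_ne i
  have t2 := h.ae_ne (i + 2 * j + 2)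
  have t3 := h.a_ne (j + 1)
  have t4 : ellTheta (a * q) p ≠ 0 := by simpa using h.a_ne 1
  have t5 : ellTheta (a * q ^ 2) p ≠ 0 := h.a_ne 2
  have t7 := h.q_ne j
  have t8 : ellTheta a p ≠ 0 := by simpa using h.a_ne 0
  rw [show q * q ^ j = q ^ (j + 1) by ring] at hqj t7
  rw [frenkelTuraevTerm, frenkelTuraevTerm, show i + 2 * (j + 1) = i + 2 * j + 2 by ring,
    h2, h2, h2, hb, hab, hqj, eq_div_of_mul_eq t1 he, eq_div_of_mul_eq t2 hae,
    eq_div_of_mul_eq t3 ha, show a * q ^ 2 * q ^ (2 * j) = a * q ^ (2 * (j + 1)) by ring,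
    show a * q ^ 2 * q / (b * q) = a * q / b * q * (q / q) by ring, div_self hq, mul_one,
    show a * q ^ 2 * c = a * c * q ^ 2 by ring, show a * q ^ 2 * d = a * d * q ^ 2 by ring,
    show a * q ^ 2 * q = a * q * q ^ 2 by ring, show a * q * q = a * q ^ 2 by ring]
  -- The cancelling pairs are supplied as a factor `1`, after which both sides agree as monomials in
  -- the theta values and their inverses.
  have p1 : (ellTheta (a * q) p)⁻¹ * (ellTheta (a * q) p) *
      ((ellTheta (q ^ (j + 1)) p)⁻¹ * ellTheta (q ^ (j + 1)) p) *
      (ellTheta a p * (ellTheta a p)⁻¹) *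
      ((ellTheta (e * q ^ i) p)⁻¹ * ellTheta (e * q ^ i) p) *
      ((ellTheta (a * q ^ (j + 1)) p)⁻¹ * ellTheta (a * q ^ (j + 1)) p) *
      ((ellTheta (a * e * q ^ (i + 2 * j + 2)) p)⁻¹ * ellTheta (a * e * q ^ (i + 2 * j + 2)) p)
      = 1 := by
    simp only [inv_mul_cancel₀ t1, inv_mul_cancel₀ t2, inv_mul_cancel₀ t3, inv_mul_cancel₀ t4,
      inv_mul_cancel₀ t7, mul_inv_cancel₀ t8, mul_one]
  refine (mul_one _).symm.trans ((congrArg _ p1.symm).trans ?_)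
  simp only [div_eq_mul_inv, mul_inv, inv_inv, mul_pow]
  ring

/-- This is `ellTheta_term_identity` divided by its right-hand side. No balancing is needed, and the
case `i = 0` or `j = 0` is included: there one piece vanishes through `θ(1;p) = 0`. -/
theorem frenkelTuraevTerm_split {a b c d e q p : ℂ} (hp : ‖p‖ < 1) (hq : q ≠ 0) (ha : a ≠ 0)
    (he : e ≠ 0) (h : FrenkelTuraevRegular a b e q p) (i j n : ℕ) (hn : i + j = n + 1) :
    frenkelTuraevTerm a b c d e q p i j =
      ellTheta (e * q ^ (n + 1)) p * ellTheta (a * e * q ^ (n + 1)) p /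
          (ellTheta (q ^ (n + 1)) p * ellTheta (a * q ^ (n + 1)) p) *
        (frenkelTuraevTerm a b c d e q p i j *
          (ellTheta (q ^ i) p * ellTheta (a * q ^ (i + 2 * j)) p /
            (ellTheta (e * q ^ i) p * ellTheta (a * e * q ^ (i + 2 * j)) p))) +
      ellTheta e p * ellTheta (a * e * q ^ (2 * (n + 1))) p /
          (ellTheta (q ^ (n + 1)) p * ellTheta (a * q ^ (n + 1)) p) *
        (frenkelTuraevTerm a b c d e q p i j *
          (q ^ i * (ellTheta (q ^ j) p * ellTheta (a * q ^ j) p) /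
            (ellTheta (e * q ^ i) p * ellTheta (a * e * q ^ (i + 2 * j)) p))) := by
  have key := ellTheta_term_identity hp ha he (pow_ne_zero i hq) (pow_ne_zero j hq)
  rw [← pow_mul, ← pow_add, show q ^ i * q ^ (j * 2) = q ^ (i + 2 * j) by ring, hn,
    show (q ^ (n + 1)) ^ 2 = q ^ (2 * (n + 1)) by ring] at key
  have t1 := h.e_ne i
  have t2 := h.ae_ne (i + 2 * j)
  have t3 := h.a_ne (n + 1)
  have t4 := h.q_ne n
  rw [show q * q ^ n = q ^ (n + 1) by ring] at t4
  generalize frenkelTuraevTerm a b c d e q p i j = T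
  generalize ellTheta (e * q ^ i) p = s1, ellTheta (a * e * q ^ (i + 2 * j)) p = s2,
    ellTheta (a * q ^ (n + 1)) p = s3, ellTheta (q ^ (n + 1)) p = s4,
    ellTheta (a * e * q ^ (n + 1)) p = s5, ellTheta (a * e * q ^ (2 * (n + 1))) p = s6 at *
  clear h
  field_simp
  linear_combination -T * key

/-- All three values share the factor `Z` introduced below; what remains is `ellTheta_sum_identity`
at `a q^(n+1), b, c, d`. The balancing condition is what matches the arguments. -/
theorem frenkelTuraevValue_split {a b c d e q p : ℂ} (hp : ‖p‖ < 1) (hq : q ≠ 0) (ha : a ≠ 0)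
    (hb : b ≠ 0) (hc : c ≠ 0) (hd : d ≠ 0) (he : b * c * d = e)
    (h : FrenkelTuraevRegular a b e q p) (n : ℕ) :
    frenkelTuraevValue a b c d e q p (n + 1) =
      ellTheta (e * q ^ (n + 1)) p * ellTheta (a * e * q ^ (n + 1)) p /
          (ellTheta (q ^ (n + 1)) p * ellTheta (a * q ^ (n + 1)) p) *
        (b * ellTheta c p * ellTheta (a * c) p * ellTheta d p * ellTheta (a * d) p /
            (ellTheta e p * ellTheta (e * q) p * ellTheta (a * e) p * ellTheta (a * e * q) p) *
          frenkelTuraevValue a b (c * q) (d * q) (e * q ^ 2) q p n) +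
      ellTheta e p * ellTheta (a * e * q ^ (2 * (n + 1))) p /
          (ellTheta (q ^ (n + 1)) p * ellTheta (a * q ^ (n + 1)) p) *
        (ellTheta b p * ellTheta (a * c) p * ellTheta (a * c * q) p *
            ellTheta (a * d) p * ellTheta (a * d * q) p /
          (ellTheta (a * q / b) p * ellTheta e p * ellTheta (a * e) p * ellTheta (a * e * q) p *
            ellTheta (a * e * q ^ 2) p) *
          frenkelTuraevValue (a * q ^ 2) (b * q) c d (e * q) q p n) := by
  have h2 (x : ℂ) (m : ℕ) : ellFac x q p (m + 2) =
      ellTheta x p * (ellTheta (x * q) p * ellFac (x * q ^ 2) q p m) := by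
    rw [ellFac_succ', ellFac_succ', show x * q * q = x * q ^ 2 by ring]
  have key := ellTheta_sum_identity hp (mul_ne_zero ha (pow_ne_zero (n + 1) hq)) hb hc hd
  rw [show a * q ^ (n + 1) * c * d = a * e / b * q ^ (n + 1) by rw [← he]; field_simp,
    show a * q ^ (n + 1) * b * c * d = a * e * q ^ (n + 1) by rw [← he]; ring, he] at key
  have t1 : ellTheta e p ≠ 0 := by simpa using h.e_ne 0
  have t2 : ellTheta (e * q) p ≠ 0 := by simpa using h.e_ne 1
  have t3 : ellTheta (a * e) p ≠ 0 := by simpa using h.ae_ne 0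
  have t4 : ellTheta (a * e * q) p ≠ 0 := by simpa using h.ae_ne 1
  have t5 : ellTheta (a * e * q ^ 2) p ≠ 0 := h.ae_ne 2
  have t6 : ellTheta (q ^ (n + 1)) p ≠ 0 := by
    rw [show q ^ (n + 1) = q * q ^ n by ring]; exact h.q_ne n
  have t7 := h.e_ne (n + 1)
  have t8 := h.ae_ne (2 * (n + 1))
  have t9 : ellTheta (a * q / b) p ≠ 0 := by simpa using h.ab_ne 0
  have t10 := h.a_ne (n + 1)
  have t11 : ellTheta (a * q ^ (n + 1) / b) p ≠ 0 := by
    rw [show a * q ^ (n + 1) / b = a * q / b * q ^ n by ring]; exact h.ab_ne n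
  have hqn : ellFac q q p n = ellFac q q p (n + 1) / ellTheta (q ^ (n + 1)) p := by
    rw [ellFac_succ, show q * q ^ n = q ^ (n + 1) by ring, mul_div_cancel_right₀ _ t6]
  have he1 : ellFac (e * q) q p n = ellFac e q p (n + 1) / ellTheta e p := by
    rw [ellFac_succ', mul_div_cancel_left₀ _ t1]
  have he2 : ellFac (e * q ^ 2) q p n = ellFac e q p (n + 1) * ellTheta (e * q ^ (n + 1)) p /
      (ellTheta e p * ellTheta (e * q) p) := by
    rw [← ellFac_succ, h2, ← mul_assoc, mul_div_cancel_left₀ _ (mul_ne_zero t1 t2)]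
  have hab : ellFac (a * q / b) q p n =
      ellFac (a * q / b) q p (n + 1) / ellTheta (a * q ^ (n + 1) / b) p := by
    rw [ellFac_succ, show a * q / b * q ^ n = a * q ^ (n + 1) / b by ring,
      mul_div_cancel_right₀ _ t11]
  have hab' : ellFac (a * q ^ 2 * q / (b * q)) q p n =
      ellFac (a * q / b) q p (n + 1) / ellTheta (a * q / b) p := by
    rw [ellFac_succ', mul_div_cancel_left₀ _ t9]
    congr 1
    field_simp
  have hae2 : ellFac (a * (e * q ^ 2)) q p (2 * n) =
      ellFac (a * e) q p (2 * (n + 1)) / (ellTheta (a * e) p * ellTheta (a * e * q) p) := by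
    rw [show 2 * (n + 1) = 2 * n + 2 by ring, h2, ← mul_assoc (ellTheta _ p),
      mul_div_cancel_left₀ _ (mul_ne_zero t3 t4), mul_assoc a]
  have hae3 : ellFac (a * q ^ 2 * (e * q)) q p (2 * n) =
      ellFac (a * e) q p (2 * (n + 1)) * ellTheta (a * e * q ^ (2 * (n + 1))) p /
        (ellTheta (a * e) p * ellTheta (a * e * q) p * ellTheta (a * e * q ^ 2) p) := by
    rw [eq_div_iff (mul_ne_zero (mul_ne_zero t3 t4) t5), ← ellFac_succ,
      show 2 * (n + 1) + 1 = (2 * n + 1) + 2 by ring, h2, ellFac_succ',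
      show a * e * q ^ 2 * q = a * q ^ 2 * (e * q) by ring]
    ring
  have hac (x : ℂ) : ellTheta (a * x) p * ellFac (a * (x * q)) q p n =
      ellFac (a * x) q p (n + 1) := by
    rw [ellFac_succ', mul_assoc a]
  have hac2 (x : ℂ) : ellTheta (a * x) p * ellTheta (a * x * q) p * ellFac (a * q ^ 2 * x) q p n =
      ellFac (a * x) q p (n + 1) * ellTheta (a * q ^ (n + 1) * x) p := by
    rw [show a * q ^ (n + 1) * x = a * x * q ^ (n + 1) by ring, ← ellFac_succ, h2,
      show a * q ^ 2 * x = a * x * q ^ 2 by ring, mul_assoc]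
  set Z := ellFac (b * c * q) q p n * ellFac (b * d * q) q p n *
    ellFac (a * c) q p (n + 1) * ellFac (a * d) q p (n + 1) *
    ellFac (a * e / b * q ^ (n + 1) * q) q p n /
    (ellFac q q p (n + 1) * ellFac e q p (n + 1) * ellFac (a * q / b) q p (n + 1) *
      ellFac (a * e) q p (2 * (n + 1))) with hZ
  have hF : frenkelTuraevValue a b c d e q p (n + 1) =
      Z * (ellTheta (b * c) p * ellTheta (b * d) p * ellTheta (a * e / b * q ^ (n + 1)) p) := by
    rw [frenkelTuraevValue, ellFac_succ' (b * c), ellFac_succ' (b * d),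
      ellFac_succ' (a * e / b * q ^ (n + 1)), hZ]
    ring
  have hG : b * ellTheta c p * ellTheta (a * c) p * ellTheta d p * ellTheta (a * d) p /
            (ellTheta e p * ellTheta (e * q) p * ellTheta (a * e) p * ellTheta (a * e * q) p) *
          frenkelTuraevValue a b (c * q) (d * q) (e * q ^ 2) q p n =
      Z * (b * ellTheta c p * ellTheta d p * ellTheta (a * q ^ (n + 1) / b) p *
        ellTheta (q ^ (n + 1)) p / ellTheta (e * q ^ (n + 1)) p) := by
    rw [frenkelTuraevValue, hqn, he2, hab, hae2, hZ, ← hac, ← hac,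
      show a * (e * q ^ 2) / b * q ^ n = a * e / b * q ^ (n + 1) * q by ring,
      ← mul_assoc b c q, ← mul_assoc b d q]
    have : (ellTheta e p * (ellTheta e p)⁻¹) * (ellTheta (e * q) p * (ellTheta (e * q) p)⁻¹) *
        (ellTheta (a * e) p * (ellTheta (a * e) p)⁻¹) *
        (ellTheta (a * e * q) p * (ellTheta (a * e * q) p)⁻¹) = 1 := by
      simp only [mul_inv_cancel₀ t1, mul_inv_cancel₀ t2, mul_inv_cancel₀ t3, mul_inv_cancel₀ t4,
        mul_one]
    refine Eq.symm ((mul_one _).symm.trans ((congrArg _ this.symm).trans ?_))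
    simp only [div_eq_mul_inv, mul_inv, inv_inv]
    ring
  have hH : ellTheta b p * ellTheta (a * c) p * ellTheta (a * c * q) p *
            ellTheta (a * d) p * ellTheta (a * d * q) p /
          (ellTheta (a * q / b) p * ellTheta e p * ellTheta (a * e) p * ellTheta (a * e * q) p *
            ellTheta (a * e * q ^ 2) p) *
          frenkelTuraevValue (a * q ^ 2) (b * q) c d (e * q) q p n =
      Z * (ellTheta b p * ellTheta (a * q ^ (n + 1) * c) p * ellTheta (a * q ^ (n + 1) * d) p *
        ellTheta (q ^ (n + 1)) p / ellTheta (a * e * q ^ (2 * (n + 1))) p) := by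
    have e1 : Z * (ellTheta b p * ellTheta (a * q ^ (n + 1) * c) p *
        ellTheta (a * q ^ (n + 1) * d) p *
        ellTheta (q ^ (n + 1)) p / ellTheta (a * e * q ^ (2 * (n + 1))) p) =
      ellFac (b * c * q) q p n * ellFac (b * d * q) q p n *
        (ellFac (a * c) q p (n + 1) * ellTheta (a * q ^ (n + 1) * c) p) *
        (ellFac (a * d) q p (n + 1) * ellTheta (a * q ^ (n + 1) * d) p) *
        ellFac (a * e / b * q ^ (n + 1) * q) q p n /
        (ellFac q q p (n + 1) * ellFac e q p (n + 1) * ellFac (a * q / b) q p (n + 1) *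
          ellFac (a * e) q p (2 * (n + 1))) * (ellTheta b p * ellTheta (q ^ (n + 1)) p /
            ellTheta (a * e * q ^ (2 * (n + 1))) p) := by rw [hZ]; ring
    rw [e1, frenkelTuraevValue, hqn, he1, hab', hae3, ← hac2, ← hac2,
      show a * q ^ 2 * (e * q) / (b * q) * q ^ n = a * e / b * q ^ (n + 1) * q by
        field_simp; ring,
      show b * q * c = b * c * q by ring, show b * q * d = b * d * q by ring]
    have : (ellTheta e p * (ellTheta e p)⁻¹) *
        (ellTheta (a * q / b) p * (ellTheta (a * q / b) p)⁻¹) *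
        (ellTheta (a * e) p * (ellTheta (a * e) p)⁻¹) *
        (ellTheta (a * e * q) p * (ellTheta (a * e * q) p)⁻¹) *
        (ellTheta (a * e * q ^ 2) p * (ellTheta (a * e * q ^ 2) p)⁻¹) = 1 := by
      simp only [mul_inv_cancel₀ t1, mul_inv_cancel₀ t3, mul_inv_cancel₀ t4, mul_inv_cancel₀ t5,
        mul_inv_cancel₀ t9, mul_one]
    refine Eq.symm ((mul_one _).symm.trans ((congrArg _ this.symm).trans ?_))
    simp only [div_eq_mul_inv, mul_inv, inv_inv]
    generalize (ellTheta (a * q * b⁻¹) p)⁻¹ = v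
    ring
  rw [hF, hG, hH]
  clear hF hG hH hac hac2 hae3 hae2 hab' hab he2 he1 hqn h2 hZ h
  generalize ellTheta (a * e * q ^ (2 * (n + 1))) p = s1, ellTheta (q ^ (n + 1)) p = s2,
    ellTheta (e * q ^ (n + 1)) p = s3, ellTheta (a * q ^ (n + 1)) p = s4 at *
  have e2 : s3 * ellTheta (a * e * q ^ (n + 1)) p / (s2 * s4) *
      (Z * (b * ellTheta c p * ellTheta d p * ellTheta (a * q ^ (n + 1) / b) p * s2 / s3)) +
      ellTheta e p * s1 / (s2 * s4) * (Z * (ellTheta b p * ellTheta (a * q ^ (n + 1) * c) p *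
        ellTheta (a * q ^ (n + 1) * d) p * s2 / s1)) =
      Z * (s3 / s3 * (s2 / s2) * (b * ellTheta c p * ellTheta d p *
        ellTheta (a * e * q ^ (n + 1)) p * ellTheta (a * q ^ (n + 1) / b) p) +
        s1 / s1 * (s2 / s2) * (ellTheta b p * ellTheta e p * ellTheta (a * q ^ (n + 1) * c) p *
          ellTheta (a * q ^ (n + 1) * d) p)) / s4 := by
    simp only [div_eq_mul_inv, mul_inv]
    ring
  rw [e2, div_self t8, div_self t6, div_self t7]
  simp only [one_mul]
  rw [← key, eq_div_iff t10]
  ring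

/-- Sum and value satisfy the same recurrence. The parameters are quantified inside the induction
because both shorter sums have shifted ones, again balanced. -/
theorem frenkelTuraev_sum {q p : ℂ} (hp : ‖p‖ < 1) (hq : q ≠ 0) (n : ℕ) :
    ∀ {a b c d e : ℂ}, a ≠ 0 → b ≠ 0 → c ≠ 0 → d ≠ 0 → b * c * d = e →
      FrenkelTuraevRegular a b e q p →
      ∑ x ∈ Finset.HasAntidiagonal.antidiagonal n, frenkelTuraevTerm a b c d e q p x.1 x.2 =
        frenkelTuraevValue a b c d e q p n := by
  induction n with
  | zero =>
    intro a b c d e ha hb hc hd he h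
    have : ellTheta a p ≠ 0 := by simpa using h.a_ne 0
    simp [frenkelTuraevTerm, frenkelTuraevValue, ellFac_zero, this]
  | succ n ih =>
    intro a b c d e ha hb hc hd he h
    have he0 : e ≠ 0 := he ▸ mul_ne_zero (mul_ne_zero hb hc) hd
    rw [frenkelTuraevValue_split hp hq ha hb hc hd he h,
      ← ih ha hb (mul_ne_zero hc hq) (mul_ne_zero hd hq) (by rw [← he]; ring) h.shift_left,
      ← ih (mul_ne_zero ha (pow_ne_zero 2 hq)) (mul_ne_zero hb hq) hc hd (by rw [← he]; ring)
        (h.shift_right hq)]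
    simp only [Finset.mul_sum]
    refine sum_antidiagonal_pascal (frenkelTuraevTerm a b c d e q p)
      (fun i j => _ * (_ * frenkelTuraevTerm a b (c * q) (d * q) (e * q ^ 2) q p i j))
      (fun i j => _ * (_ * frenkelTuraevTerm (a * q ^ 2) (b * q) c d (e * q) q p i j)) n ?_ ?_ ?_
    · rw [frenkelTuraevTerm_left h]
      refine (frenkelTuraevTerm_split hp hq ha he0 h (n + 1) 0 n rfl).trans ?_
      simp only [pow_zero, ellTheta_one, zero_mul, mul_zero, zero_div, add_zero]
    · rw [frenkelTuraevTerm_right hq h]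
      refine (frenkelTuraevTerm_split hp hq ha he0 h 0 (n + 1) n (by ring)).trans ?_
      simp only [pow_zero, ellTheta_one, zero_mul, mul_zero, zero_div, zero_add]
    · intro i j hij
      rw [frenkelTuraevTerm_left h, frenkelTuraevTerm_right hq h]
      exact frenkelTuraevTerm_split hp hq ha he0 h (i + 1) (j + 1) n (by omega)

/-! ### The matrix identities and the elliptic theorem -/

theorem ellTheta_sq {p : ℂ} (hp : ‖p‖ < 1) (x : ℂ) :
    ellTheta (x ^ 2) (p ^ 2) = ellTheta x p * ellTheta (-x) p := by
  rw [ellTheta, ellTheta, ellTheta,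
    ← (multipliable_ellTheta hp x).tprod_mul (multipliable_ellTheta hp (-x))]
  refine tprod_congr fun j => ?_
  rw [← pow_mul, ← pow_mul, div_neg, pow_mul', pow_mul' p 2 (j + 1)]
  ring

theorem ellFac_sq {p : ℂ} (hp : ‖p‖ < 1) (x q : ℂ) (n : ℕ) :
    ellFac (x ^ 2) (q ^ 2) (p ^ 2) n = ellFac x q p n * ellFac (-x) q p n := by
  rw [ellFac, ellFac, ellFac, ← Finset.prod_mul_distrib]
  refine Finset.prod_congr rfl fun j _ => ?_
  rw [← neg_mul_eq_neg_mul, ← ellTheta_sq hp]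
  congr 1
  ring

theorem ellFac_mul_ellTheta (x q p : ℂ) (n : ℕ) :
    ellFac x q p n * ellTheta (x * q ^ n) p = ellTheta x p * ellFac (x * q) q p n := by
  rw [← ellFac_succ, ellFac_succ']

/-- Interchange of summation, with `r = s + j` and `i + j = n - s`, which are the indices of the
Frenkel-Turaev sum. -/
theorem sum_range_mul_sum_range {R : Type*} [CommSemiring R] (A : ℕ → R) (B : ℕ → ℕ → R)
    (f : ℕ → R) (n : ℕ) :
    ∑ r ∈ Finset.range (n + 1), A r * ∑ s ∈ Finset.range (r + 1), B r s * f s =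
      ∑ s ∈ Finset.range (n + 1),
        (∑ x ∈ Finset.HasAntidiagonal.antidiagonal (n - s), A (s + x.2) * B (s + x.2) s) * f s := by
  simp only [Finset.mul_sum, Finset.sum_mul]
  rw [Finset.sum_comm' (t' := Finset.range (n + 1)) (s' := fun s => Finset.Ico s (n + 1))
    (by intro x y; simp only [Finset.mem_range, Finset.mem_Ico]; omega)]
  refine Finset.sum_congr rfl fun s hs => ?_
  rw [Finset.sum_Ico_eq_sum_range, ← Finset.Nat.sum_antidiagonal_swap,
    Finset.Nat.sum_antidiagonal_eq_sum_range_succ_mk,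
    show n + 1 - s = (n - s).succ by have := Finset.mem_range.mp hs; omega]
  exact Finset.sum_congr rfl fun j _ => (mul_assoc _ _ _).symm

theorem EllipticRegular.theta_ne {a k q p : ℂ} (h : EllipticRegular a k q p) (i : ℕ) :
    ellTheta (k * q ^ i) p ≠ 0 := by
  obtain ⟨-, -, -, -, hk, hf⟩ := h
  cases i with
  | zero => simpa using hk
  | succ i =>
    rw [pow_succ', ← mul_assoc]
    exact ellTheta_ne_zero_of_ellFac (fun n => (hf n).2.2) i

/-- Splitting off the first `2s` factors of the long factorials shifts `k` to `k q^(2s)`; the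
prefactor depends only on `s` and `s + i + j`. -/
theorem ellInvKernel_mul_ellKernel {a k q p : ℂ} (h : EllipticRegular a k q p) (i j s : ℕ) :
    ellInvKernel a k q p (s + i + j) (s + j) * ellKernel a k q p (s + j) s =
      ellTheta (a * q ^ (2 * (s + i + j))) p / ellTheta a p *
        (ellTheta (k * q ^ (2 * s)) p / ellTheta k p) *
        (ellFac a q p (2 * s) / ellFac (k * q) q p (2 * s)) *
        (ellFac k q p (2 * s) / ellFac (a * q) q p (2 * s)) *
      frenkelTuraevTerm (k * q ^ (2 * s)) (k / a) (a / k) q q q p i j := by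
  have hth := h.theta_ne (2 * s)
  obtain ⟨ha, hk, hq, -, -, hf⟩ := h
  have hqi := (hf i).1
  have hN : ellFac (k * q ^ (2 * s) * q) q p (i + 2 * j) ≠ 0 := fun h0 => by
    apply (hf (2 * s + (i + 2 * j))).2.2
    rw [ellFac_add, show k * q * q ^ (2 * s) = k * q ^ (2 * s) * q by ring, h0, mul_zero]
  rw [ellInvKernel, ellKernel, frenkelTuraevTerm, show s + i + j - (s + j) = i by omega,
    show s + j - s = j by omega, show s + i + j + (s + j) = 2 * s + (i + 2 * j) by ring,
    show s + j + s = 2 * s + j by ring, ellFac_add a, ellFac_add (k * q), ellFac_add k,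
    ellFac_add (a * q), show k * q * q ^ (2 * s) = k * q ^ (2 * s) * q by ring,
    show k * q ^ (2 * s) * q / (k / a) = a * q * q ^ (2 * s) by field_simp,
    show k * q ^ (2 * s) * (a / k) = a * q ^ (2 * s) by field_simp,
    show k * q ^ (2 * s) * q ^ (2 * j) = k * q ^ (2 * (s + j)) by ring]
  have : ellTheta (k * q ^ (2 * s)) p * (ellTheta (k * q ^ (2 * s)) p)⁻¹ *
      (ellFac q q p i * (ellFac q q p i)⁻¹) *
      (ellFac (k * q ^ (2 * s) * q) q p (i + 2 * j) *
        (ellFac (k * q ^ (2 * s) * q) q p (i + 2 * j))⁻¹) = 1 := by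
    simp only [mul_inv_cancel₀ hth, mul_inv_cancel₀ hqi, mul_inv_cancel₀ hN, mul_one]
  refine (mul_one _).symm.trans ((congrArg _ this.symm).trans ?_)
  generalize ellTheta (k * q ^ (2 * s)) p = X1, ellFac (k * q ^ (2 * s) * q) q p (i + 2 * j) = X2
  simp only [div_eq_mul_inv, mul_inv]
  ring

/-- The matrices which define an elliptic WP Bailey pair are inverse to each other. -/
theorem sum_ellInvKernel_mul_ellKernel {a k q p : ℂ} (hp : ‖p‖ < 1) (h : EllipticRegular a k q p)
    {n s : ℕ} (hs : s ≤ n) :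
    ∑ x ∈ Finset.HasAntidiagonal.antidiagonal (n - s),
      ellInvKernel a k q p n (s + x.2) * ellKernel a k q p (s + x.2) s =
        if s = n then 1 else 0 := by
  have hk' := h.theta_ne
  obtain ⟨ha, hk, hq, hta, htk, hf⟩ := id h
  have hreg : FrenkelTuraevRegular (k * q ^ (2 * s)) (k / a) q q p := by
    refine ⟨ellTheta_ne_zero_of_ellFac fun n => (hf n).1, fun i => ?_,
      ellTheta_ne_zero_of_ellFac fun n => (hf n).1, fun i => ?_, fun i => ?_⟩
    · rw [mul_assoc, ← pow_add]; exact hk' _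
    · rw [mul_assoc, mul_assoc, ← pow_succ', ← pow_add]; exact hk' _
    · rw [show k * q ^ (2 * s) * q / (k / a) * q ^ i = a * q * q ^ (2 * s + i) by
        rw [pow_add]; field_simp]
      exact ellTheta_ne_zero_of_ellFac (fun n => (hf n).2.1) _
  have hsum := frenkelTuraev_sum hp hq (n - s)
    (mul_ne_zero hk (pow_ne_zero (2 * s) hq)) (div_ne_zero hk ha) (div_ne_zero ha hk) hq
    (show k / a * (a / k) * q = q by field_simp) hreg
  rw [Finset.sum_congr rfl (g := fun x => _ * frenkelTuraevTerm (k * q ^ (2 * s)) (k / a) (a / k)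
    q q q p x.1 x.2) fun x hx => ?_, ← Finset.mul_sum, hsum]
  rotate_left
  · have hx' := Finset.HasAntidiagonal.mem_antidiagonal.mp hx
    have := ellInvKernel_mul_ellKernel h x.1 x.2 s
    rwa [show s + x.1 + x.2 = n by omega] at this
  split_ifs with hsn
  · subst hsn
    -- On the diagonal the sum has one term, and the prefactor telescopes to `1`.
    have e1 := ellFac_mul_ellTheta a q p (2 * s)
    have e2 := ellFac_mul_ellTheta k q p (2 * s)
    have n1 := (hf (2 * s)).2.1
    have n2 := (hf (2 * s)).2.2
    rw [Nat.sub_self, frenkelTuraevValue]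
    simp only [mul_zero, ellFac_zero, mul_one, div_one]
    rw [show ∀ x1 x2 x3 x4 x5 x6 x7 x8 : ℂ, x1 / x2 * (x3 / x4) * (x5 / x6) * (x7 / x8) =
      (x5 * x1) / (x2 * x8) * ((x7 * x3) / (x4 * x6)) by intros; ring, e1, e2,
      div_self (mul_ne_zero hta n1), div_self (mul_ne_zero htk n2), mul_one]
  -- Off the diagonal, the value contains the factorial of `b c = 1`, whose first factor is `θ(1;p)
  -- = 0`.
  · obtain ⟨d, hd⟩ : ∃ d, n - s = d + 1 := ⟨n - s - 1, by omega⟩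
    rw [hd, frenkelTuraevValue, ellFac_succ', show k / a * (a / k) = 1 by field_simp, ellTheta_one]
    simp

theorem ellQuadCoeff_mul_ellKernel {a k m q p κ : ℂ} (hp : ‖p‖ < 1) (ha : a ≠ 0) (hm : m ≠ 0)
    (hκ : κ ^ 2 = k) (i j s : ℕ) (hth : ellTheta (m * q ^ (2 * s)) p ≠ 0) :
    ellQuadCoeff a k m q p (s + i + j) (s + j) * ellKernel a m q p (s + j) s =
      ellFac (-(m * q)) q p (2 * (s + i + j)) / ellFac (-(a * q)) q p (2 * (s + i + j)) *
        (ellTheta (m * q ^ (2 * s)) p / ellTheta m p) *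
        (ellFac k (q ^ 2) (p ^ 2) (2 * s) / ellFac (m ^ 2 * q ^ 2) (q ^ 2) (p ^ 2) (2 * s)) *
        (ellFac m q p (2 * s) / ellFac (a * q) q p (2 * s)) *
      frenkelTuraevTerm (m * q ^ (2 * s)) (m / a) (κ / m) (-(κ / m)) (-q) q p i j := by
  rw [ellQuadCoeff, ellKernel, frenkelTuraevTerm, show s + i + j - (s + j) = i by omega,
    show s + j - s = j by omega, show s + i + j + (s + j) = 2 * s + (i + 2 * j) by ring,
    show s + j + s = 2 * s + j by ring, ellFac_add m, ellFac_add k, ellFac_add (m ^ 2 * q ^ 2),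
    ellFac_add (a * q),
    show k / m ^ 2 = (κ / m) ^ 2 by rw [← hκ]; ring, ellFac_sq hp, ellFac_sq hp,
    show m ^ 2 * q ^ 2 * (q ^ 2) ^ (2 * s) = (m * q ^ (2 * s) * q) ^ 2 by ring, ellFac_sq hp,
    show k * (q ^ 2) ^ (2 * s) = (κ * q ^ (2 * s)) ^ 2 by rw [← hκ]; ring, ellFac_sq hp,
    show m * q ^ (2 * s) * q / (m / a) = a * q * q ^ (2 * s) by field_simp,
    mul_neg (m * q ^ (2 * s)), mul_neg (m * q ^ (2 * s)),
    show m * q ^ (2 * s) * (κ / m) = κ * q ^ (2 * s) by field_simp,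
    show m * q ^ (2 * s) * q ^ (2 * j) = m * q ^ (2 * (s + j)) by ring]
  refine (mul_one _).symm.trans ((congrArg _ (mul_inv_cancel₀ hth).symm).trans ?_)
  generalize ellTheta (m * q ^ (2 * s)) p = X1
  simp only [div_eq_mul_inv, mul_inv]
  ring

/-- The quadratic coefficients turn the matrix of an elliptic WP Bailey pair at `(a, m; q, p)`
into the matrix at `(a ^ 2, k; q ^ 2, p ^ 2)`. -/
theorem sum_ellQuadCoeff_mul_ellKernel {a k m q p : ℂ} (hp : ‖p‖ < 1) (hm : m = k / (a * q))
    (h : EllipticRegular a m q p) (h' : EllipticRegular (a ^ 2) k (q ^ 2) (p ^ 2))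
    (h1 : ∀ n, ellFac (-(a * q)) q p n ≠ 0)
    (h2 : ∀ n, ellFac (m ^ 2 * q ^ 2) (q ^ 2) (p ^ 2) n ≠ 0) {n s : ℕ} (hs : s ≤ n) :
    ∑ x ∈ Finset.HasAntidiagonal.antidiagonal (n - s),
      ellQuadCoeff a k m q p n (s + x.2) * ellKernel a m q p (s + x.2) s =
        ellKernel (a ^ 2) k (q ^ 2) (p ^ 2) n s := by
  have hm' := h.theta_ne
  obtain ⟨ha, hm0, hq, hta, htm, hf⟩ := id h
  obtain ⟨-, hk, -, -, -, hf'⟩ := h'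
  obtain ⟨κ, hκ⟩ := IsAlgClosed.exists_pow_nat_eq k (n := 2) (by norm_num)
  have hκ0 : κ ≠ 0 := by rintro rfl; simp [hk.symm] at hκ
  have hkm : κ ^ 2 = m * (a * q) := by rw [hκ, hm]; field_simp
  have h2' (x : ℕ) : ellFac (m * q) q p x ≠ 0 ∧ ellFac (-(m * q)) q p x ≠ 0 := by
    have := h2 x
    rw [← mul_pow, ellFac_sq hp] at this
    exact mul_ne_zero_iff.mp this
  have hq' (x : ℕ) : ellFac (-q) q p x ≠ 0 := by
    have := (hf' x).1
    rw [ellFac_sq hp] at this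
    exact (mul_ne_zero_iff.mp this).2
  have hreg : FrenkelTuraevRegular (m * q ^ (2 * s)) (m / a) (-q) q p := by
    refine ⟨ellTheta_ne_zero_of_ellFac fun n => (hf n).1, fun i => ?_,
      ellTheta_ne_zero_of_ellFac hq', fun i => ?_, fun i => ?_⟩
    · rw [mul_assoc, ← pow_add]; exact hm' _
    · rw [show m * q ^ (2 * s) * -q * q ^ i = -(m * q) * q ^ (2 * s + i) by ring]
      exact ellTheta_ne_zero_of_ellFac (fun n => (h2' n).2) _
    · rw [show m * q ^ (2 * s) * q / (m / a) * q ^ i = a * q * q ^ (2 * s + i) by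
        rw [pow_add]; field_simp]
      exact ellTheta_ne_zero_of_ellFac (fun n => (hf n).2.1) _
  -- Here `b c d = -κ²/(am) = -k/(am)`, which equals `e = -q` precisely because `m = k/(aq)`.
  have hsum := frenkelTuraev_sum hp hq (n - s)
    (mul_ne_zero hm0 (pow_ne_zero (2 * s) hq)) (div_ne_zero hm0 ha) (div_ne_zero hκ0 hm0)
    (neg_ne_zero.mpr (div_ne_zero hκ0 hm0))
    (show m / a * (κ / m) * -(κ / m) = -q by field_simp; rw [hkm]; ring) hreg
  rw [Finset.sum_congr rfl (g := fun x => _ * frenkelTuraevTerm (m * q ^ (2 * s)) (m / a) (κ / m)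
    (-(κ / m)) (-q) q p x.1 x.2) fun x hx => ?_, ← Finset.mul_sum, hsum]
  rotate_left
  · have hx' := Finset.HasAntidiagonal.mem_antidiagonal.mp hx
    have := ellQuadCoeff_mul_ellKernel hp ha hm0 hκ x.1 x.2 s (hm' _)
    rwa [show s + x.1 + x.2 = n by omega] at this
  obtain ⟨N, rfl⟩ := Nat.exists_eq_add_of_le hs
  -- In the value, the factorials pair up as `x, -x` into base `q²`. The two unpaired ones, starting
  -- at `-m q^(2s+1)` and `-a q^(2s+N+1)`, cancel against the ends of `(-mq)_{2n}` and `(-aq)_{2n}`.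
  rw [Nat.add_sub_cancel_left, frenkelTuraevValue, ellKernel, Nat.add_sub_cancel_left,
    show s + N + s = 2 * s + N by ring, ellFac_add k, ← mul_pow a q, ← mul_pow m q,
    show k / a ^ 2 = (κ / a) ^ 2 by rw [← hκ]; ring,
    show k * (q ^ 2) ^ (2 * s) = (κ * q ^ (2 * s)) ^ 2 by rw [← hκ]; ring,
    ellFac_sq hp, ellFac_sq hp, ellFac_sq hp, ellFac_sq hp, ellFac_sq hp,
    mul_neg, mul_neg, mul_neg,
    show m / a * (κ / m) = κ / a by field_simp,
    show m * q ^ (2 * s) * (κ / m) = κ * q ^ (2 * s) by field_simp,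
    show m * q ^ (2 * s) * q / (m / a) = a * q * q ^ (2 * s) by field_simp,
    show -(m * q ^ (2 * s) * q) / (m / a) * q ^ N = -(a * q) * q ^ (2 * s + N) by
      rw [pow_add]; field_simp,
    show -(m * q ^ (2 * s) * q) = -(m * q) * q ^ (2 * s) by ring,
    show 2 * (s + N) = 2 * s + N + N by ring,
    show ellFac (-(m * q)) q p (2 * s + N + N) = ellFac (-(m * q)) q p (2 * s + 2 * N) by
      congr 1; ring, ellFac_add (-(m * q)), ellFac_add (-(a * q)) q p (2 * s + N),
    ellFac_add (a * q)]
  have e1 := ellFac_mul_ellTheta m q p (2 * s)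
  have n1 := (h2' (2 * s)).1
  have n2 := (h2' (2 * s)).2
  have n3 : ellFac (-(m * q) * q ^ (2 * s)) q p (2 * N) ≠ 0 :=
    ellFac_ne_zero fun i _ => by
      rw [mul_assoc, ← pow_add]
      exact ellTheta_ne_zero_of_ellFac (fun n => (h2' n).2) _
  have n4 : ellFac (-(a * q) * q ^ (2 * s + N)) q p N ≠ 0 :=
    ellFac_ne_zero fun i _ => by
      rw [mul_assoc, ← pow_add]
      exact ellTheta_ne_zero_of_ellFac h1 _
  have e2 : ellTheta (m * q ^ (2 * s)) p = ellTheta m p * ellFac (m * q) q p (2 * s) /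
      ellFac m q p (2 * s) := by
    rw [← e1, mul_div_cancel_left₀]
    exact ellFac_ne_zero fun i _ => hm' i
  have n5 : ellFac m q p (2 * s) ≠ 0 := ellFac_ne_zero fun i _ => hm' i
  rw [e2]
  have : ellTheta m p * (ellTheta m p)⁻¹ *
      (ellFac (m * q) q p (2 * s) * (ellFac (m * q) q p (2 * s))⁻¹) *
      (ellFac (-(m * q)) q p (2 * s) * (ellFac (-(m * q)) q p (2 * s))⁻¹) *
      (ellFac (-(m * q) * q ^ (2 * s)) q p (2 * N) *
        (ellFac (-(m * q) * q ^ (2 * s)) q p (2 * N))⁻¹) *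
      (ellFac (-(a * q) * q ^ (2 * s + N)) q p N *
        (ellFac (-(a * q) * q ^ (2 * s + N)) q p N)⁻¹) *
      (ellFac m q p (2 * s) * (ellFac m q p (2 * s))⁻¹) = 1 := by
    simp only [mul_inv_cancel₀ htm, mul_inv_cancel₀ n1, mul_inv_cancel₀ n2, mul_inv_cancel₀ n3,
      mul_inv_cancel₀ n4, mul_inv_cancel₀ n5, mul_one]
  refine Eq.symm ((mul_one _).symm.trans ((congrArg _ this.symm).trans ?_))
  simp only [div_eq_mul_inv, mul_inv]
  ring

theorem isEllipticWPBaileyPair_quadratic {a k m q p : ℂ} (hp : ‖p‖ < 1) (hm : m = k / (a * q))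
    (h : EllipticRegular a m q p) (h' : EllipticRegular (a ^ 2) k (q ^ 2) (p ^ 2))
    (h1 : ∀ n, ellFac (-(a * q)) q p n ≠ 0)
    (h2 : ∀ n, ellFac (m ^ 2 * q ^ 2) (q ^ 2) (p ^ 2) n ≠ 0) {α β α' β' : ℕ → ℂ}
    (hαβ : IsEllipticWPBaileyPair a m q p α β) (hα' : ∀ n, α' n = α n)
    (hβ' : ∀ n, β' n = ∑ r ∈ Finset.range (n + 1), ellQuadCoeff a k m q p n r * β r) :
    IsEllipticWPBaileyPair (a ^ 2) k (q ^ 2) (p ^ 2) α' β' := by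
  have hp2 : ‖p ^ 2‖ < 1 := by
    rw [norm_pow]; exact pow_lt_one₀ (norm_nonneg _) hp two_ne_zero
  have hβ (n : ℕ) : β' n =
      ∑ r ∈ Finset.range (n + 1), ellKernel (a ^ 2) k (q ^ 2) (p ^ 2) n r * α' r := by
    rw [hβ']
    simp only [hαβ.1, hα']
    rw [sum_range_mul_sum_range]
    refine Finset.sum_congr rfl fun s hs => ?_
    rw [sum_ellQuadCoeff_mul_ellKernel hp hm h h' h1 h2 (Finset.mem_range_succ_iff.mp hs)]
  refine ⟨hβ, fun n => ?_⟩
  simp only [hβ]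
  rw [sum_range_mul_sum_range, Finset.sum_eq_single n]
  · rw [sum_ellInvKernel_mul_ellKernel hp2 h' le_rfl, if_pos rfl, one_mul]
  · intro s hs hsn
    rw [sum_ellInvKernel_mul_ellKernel hp2 h' (Finset.mem_range_succ_iff.mp hs), if_neg hsn,
      zero_mul]
  · simp

/-! ### The case `p = 0` and the limit `p → 0` -/

theorem ellFac_zero_right (x q : ℂ) (n : ℕ) : ellFac x q 0 n = basicFac x q n := by
  simp only [ellFac, basicFac, ellTheta_zero_right]

theorem isEllipticWPBaileyPair_zero_iff {a k q : ℂ} {α β : ℕ → ℂ} :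
    IsEllipticWPBaileyPair a k q 0 α β ↔ IsWPBaileyPair a k q α β := by
  simp only [IsEllipticWPBaileyPair, IsWPBaileyPair, ellKernel, ellInvKernel, basicKernel,
    basicInvKernel, ellFac_zero_right, ellTheta_zero_right]

theorem ellipticRegular_zero_iff {a k q : ℂ} :
    EllipticRegular a k q 0 ↔ BasicRegular a k q := by
  simp only [EllipticRegular, BasicRegular, ellFac_zero_right, ellTheta_zero_right]

theorem ellQuadCoeff_zero_right (a k m q : ℂ) (n r : ℕ) :
    ellQuadCoeff a k m q 0 n r = basicQuadCoeff a k m q n r := by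
  simp only [ellQuadCoeff, basicQuadCoeff, zero_pow two_ne_zero, ellFac_zero_right,
    ellTheta_zero_right]

/-- Dominated convergence for the two infinite products separately, with geometric majorants on `‖p‖
≤ 1/2`. -/
theorem tendsto_ellTheta (z : ℂ) : Tendsto (fun p => ellTheta z p) (𝓝 0) (𝓝 (1 - z)) := by
  have hb : ∀ᶠ p : ℂ in 𝓝 0, ‖p‖ ≤ 1 / 2 := by
    filter_upwards [Metric.ball_mem_nhds (0 : ℂ) (by norm_num : (0 : ℝ) < 1 / 2)] with p hp
    exact (mem_ball_zero_iff.mp hp).le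
  have hg : Summable fun j : ℕ => (1 / 2 : ℝ) ^ j :=
    summable_geometric_of_lt_one (by norm_num) (by norm_num)
  have h1 : Tendsto (fun p : ℂ => ∏' j : ℕ, (1 + -(z * p ^ j))) (𝓝 0)
      (𝓝 (∏' j : ℕ, (1 + -(z * 0 ^ j)))) := by
    refine tendsto_tprod_one_add_of_dominated_convergence (hg.mul_left ‖z‖) (fun j => ?_) ?_
    · exact Continuous.tendsto (by fun_prop) 0
    · filter_upwards [hb] with p hp j
      rw [norm_neg, norm_mul, norm_pow]
      gcongr
  have h2 : Tendsto (fun p : ℂ => ∏' j : ℕ, (1 + -(p ^ (j + 1) / z))) (𝓝 0)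
      (𝓝 (∏' j : ℕ, (1 + -(0 ^ (j + 1) / z)))) := by
    refine tendsto_tprod_one_add_of_dominated_convergence
      (((summable_nat_add_iff 1).mpr hg).div_const ‖z‖) (fun j => ?_) ?_
    · exact Continuous.tendsto (by fun_prop) 0
    · filter_upwards [hb] with p hp j
      rw [norm_neg, norm_div, norm_pow]
      gcongr
  have h3 : (∏' j : ℕ, (1 + -(z * 0 ^ j))) * ∏' j : ℕ, (1 + -(0 ^ (j + 1) / z)) = 1 - z := by
    rw [tprod_eq_mulSingle 0 fun j hj => by simp [hj]]
    simp [sub_eq_add_neg]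
  rw [← h3]
  refine (h1.mul h2).congr' ?_
  filter_upwards [hb] with p hp
  have hp1 : ‖p‖ < 1 := hp.trans_lt (by norm_num)
  rw [ellTheta, ← Multipliable.tprod_mul]
  · simp only [← sub_eq_add_neg]
  · refine multipliable_one_add_of_summable ?_
    simp only [norm_neg, norm_mul, norm_pow]
    exact (summable_geometric_of_lt_one (norm_nonneg _) hp1).mul_left _
  · refine multipliable_one_add_of_summable ?_
    simp only [norm_neg, norm_div]
    exact (summable_norm_pow_succ hp1).div_const _

theorem tendsto_ellFac (x q : ℂ) (n : ℕ) :
    Tendsto (fun p => ellFac x q p n) (𝓝 0) (𝓝 (basicFac x q n)) :=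
  tendsto_finsetProd _ fun _ _ => tendsto_ellTheta _

theorem tendsto_ellKernel {a k q : ℂ} (h : BasicRegular a k q) (n r : ℕ) :
    Tendsto (fun p => ellKernel a k q p n r) (𝓝 0) (𝓝 (basicKernel a k q n r)) := by
  obtain ⟨-, -, -, -, -, hf⟩ := h
  exact ((tendsto_ellFac _ _ _).div (tendsto_ellFac _ _ _) (hf _).1).mul
    ((tendsto_ellFac _ _ _).div (tendsto_ellFac _ _ _) (hf _).2.1)

theorem tendsto_ellInvKernel {a k q : ℂ} (h : BasicRegular a k q) (n r : ℕ) :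
    Tendsto (fun p => ellInvKernel a k q p n r) (𝓝 0) (𝓝 (basicInvKernel a k q n r)) := by
  obtain ⟨-, -, -, ha, hk, hf⟩ := h
  exact (((((tendsto_ellTheta _).div (tendsto_ellTheta _) ha).mul
    ((tendsto_ellTheta _).div (tendsto_ellTheta _) hk)).mul
    ((tendsto_ellFac _ _ _).div (tendsto_ellFac _ _ _) (hf _).1)).mul
    ((tendsto_ellFac _ _ _).div (tendsto_ellFac _ _ _) (hf _).2.2)).mul_const _

theorem tendsto_sq_nhds_zero : Tendsto (fun p : ℂ => p ^ 2) (𝓝 0) (𝓝 0) :=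
  Continuous.tendsto' (by fun_prop) 0 0 (by simp)

theorem tendsto_ellQuadCoeff {a k m q : ℂ} (h : BasicRegular a m q)
    (h' : BasicRegular (a ^ 2) k (q ^ 2)) (h1 : ∀ n, basicFac (-(a * q)) q n ≠ 0)
    (h2 : ∀ n, basicFac (m ^ 2 * q ^ 2) (q ^ 2) n ≠ 0) (n r : ℕ) :
    Tendsto (fun p => ellQuadCoeff a k m q p n r) (𝓝 0) (𝓝 (basicQuadCoeff a k m q n r)) := by
  obtain ⟨-, -, -, -, hm, -⟩ := h
  obtain ⟨-, -, -, -, -, hf'⟩ := h'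
  have hsq (x : ℂ) (l : ℕ) := (tendsto_ellFac x (q ^ 2) l).comp tendsto_sq_nhds_zero
  exact (((((tendsto_ellFac _ _ _).div (tendsto_ellFac _ _ _) (h1 _)).mul
    ((tendsto_ellTheta _).div (tendsto_ellTheta _) hm)).mul
    ((hsq _ _).div (hsq _ _) (hf' _).1)).mul ((hsq _ _).div (hsq _ _) (h2 _))).mul_const _

/-- Quadratic elliptic WP Bailey lemma, and its limit `p → 0`. The first part is the elliptic
statement; the hypotheses other than `‖p‖ < 1` and `m = k / (a q)` only say that no denominator
occurring in it vanishes. The second part says that as `p → 0` all coefficients of the elliptic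
statement converge to those of the basic one, and that the basic statement holds. -/
theorem theorem3p3 :
    (∀ a k m q p : ℂ, ‖p‖ < 1 → m = k / (a * q) →
      EllipticRegular a m q p →
      EllipticRegular (a ^ 2) k (q ^ 2) (p ^ 2) →
      (∀ n, ellFac (-(a * q)) q p n ≠ 0) →
      (∀ n, ellFac (m ^ 2 * q ^ 2) (q ^ 2) (p ^ 2) n ≠ 0) →
      ∀ α β α' β' : ℕ → ℂ,
        IsEllipticWPBaileyPair a m q p α β →
        (∀ n, α' n = α n) →
        (∀ n, β' n = ∑ r ∈ Finset.range (n + 1), ellQuadCoeff a k m q p n r * β r) →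
        IsEllipticWPBaileyPair (a ^ 2) k (q ^ 2) (p ^ 2) α' β') ∧
    (∀ a k m q : ℂ, m = k / (a * q) →
      BasicRegular a m q →
      BasicRegular (a ^ 2) k (q ^ 2) →
      (∀ n, basicFac (-(a * q)) q n ≠ 0) →
      (∀ n, basicFac (m ^ 2 * q ^ 2) (q ^ 2) n ≠ 0) →
      (∀ n r : ℕ, r ≤ n →
        Tendsto (fun p : ℂ => ellKernel a m q p n r) (𝓝 0) (𝓝 (basicKernel a m q n r)) ∧
        Tendsto (fun p : ℂ => ellInvKernel a m q p n r) (𝓝 0)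
          (𝓝 (basicInvKernel a m q n r)) ∧
        Tendsto (fun p : ℂ => ellKernel (a ^ 2) k (q ^ 2) (p ^ 2) n r) (𝓝 0)
          (𝓝 (basicKernel (a ^ 2) k (q ^ 2) n r)) ∧
        Tendsto (fun p : ℂ => ellInvKernel (a ^ 2) k (q ^ 2) (p ^ 2) n r) (𝓝 0)
          (𝓝 (basicInvKernel (a ^ 2) k (q ^ 2) n r)) ∧
        Tendsto (fun p : ℂ => ellQuadCoeff a k m q p n r) (𝓝 0)
          (𝓝 (basicQuadCoeff a k m q n r))) ∧
      ∀ α β α' β' : ℕ → ℂ,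
        IsWPBaileyPair a m q α β →
        (∀ n, α' n = α n) →
        (∀ n, β' n = ∑ r ∈ Finset.range (n + 1), basicQuadCoeff a k m q n r * β r) →
        IsWPBaileyPair (a ^ 2) k (q ^ 2) α' β') := by
  refine ⟨fun a k m q p hp hm h h' h1 h2 α β α' β' hαβ hα' hβ' =>
    isEllipticWPBaileyPair_quadratic hp hm h h' h1 h2 hαβ hα' hβ',
    fun a k m q hm h h' h1 h2 => ⟨fun n r _ => ⟨tendsto_ellKernel h n r, tendsto_ellInvKernel h n r,
      (tendsto_ellKernel h' n r).comp tendsto_sq_nhds_zero,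
      (tendsto_ellInvKernel h' n r).comp tendsto_sq_nhds_zero,
      tendsto_ellQuadCoeff h h' h1 h2 n r⟩, fun α β α' β' hαβ hα' hβ' => ?_⟩⟩
  -- The basic statement is the elliptic one at `p = 0`, where nome `p²` is again `0`; no passage to
  -- the limit is needed.
  have h0 : (0 : ℂ) ^ 2 = 0 := zero_pow two_ne_zero
  rw [← isEllipticWPBaileyPair_zero_iff, ← h0]
  refine isEllipticWPBaileyPair_quadratic (by simp) hm (ellipticRegular_zero_iff.mpr h)
    (by rwa [h0, ellipticRegular_zero_iff]) (by simpa only [ellFac_zero_right] using h1)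
    (by simpa only [h0, ellFac_zero_right] using h2) (isEllipticWPBaileyPair_zero_iff.mpr hαβ) hα'
    (by simpa only [ellQuadCoeff_zero_right] using hβ')
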